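/- Let $f\in C^2(\mathbb R\times\mathbb R,\mathbb R)$ be bounded and let $\lambda_-,\lambda_+\in\mathbb R$. Assume that for all $\lambda\in[\lambda_-,\lambda_+]$, except at most finitely many in $(\lambda_-,\lambda_+)$, all equilibria of $\dot x=f(x,\lambda)$ are hyperbolic (i.e. $\partial_xf\neq0$ there). Let $X^s:[\lambda_-,\lambda_+]\to\mathbb R$ be continuous such that, for every $\lambda\in[\lambda_-,\lambda_+]$, $X^s(\lambda)$ is a stable hyperbolic equilibrium of $\dot x=f(x,\lambda)$ (i.e. $f=0$, $\partial_xf<0$ there), and put $X^s_\pm=X^s(\lambda_\pm)$. Let $\Lambda\in C^2(\mathbb R,[\lambda_-,\lambda_+])$ be strictly increasing with $\Lambda(t)\to\lambda_\pm$ and $\Lambda'(t)\to0$ as $t\to\pm\infty$, and let $p>0$ satisfy $\partial_xf(X^s(\Lambda(t)),\Lambda(t))<-p$ for all $t\in\mathbb R$. Assume finally that no equilibrium escapes to infinity as $\lambda\uparrow\lambda_+$, in the following sense: there is $\lambda_0\in[\lambda_-,\lambda_+)$ such that for every $R\in\mathbb R$ there are $K\ge R$ and $K'\le R$ with $f(K,\lambda)\ne0$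 and $f(K',\lambda)\neq0$ for all $\lambda\in[\lambda_0,\lambda_+]$. For $r>0$ consider $$\dot x=f(x,\Lambda(rt)),\qquad(\ast_r)$$ and let $x^r_-$ be the unique maximally continued solution of $(\ast_r)$ with $x^r_-(t)\to X^s_-$ as $t\to-\infty$ (the locally pullback attracting solution). For an unstable hyperbolic equilibrium $X^u_+$ of $\dot x=f(x,\lambda_+)$ (i.e. $f=0$, $\partial_xf>0$ there), let $x^r_+$ be the unique maximally continued solution of $(\ast_r)$ with $x^r_+(t)\to X^u_+$ as $t\to+\infty$ (the locally pullback repelling solution). We say that $x^r_-$ end-point tracks $X^s$ if it is defined on all of $\mathbb R$ and $x^r_-(t)\to X^s_+$ as $t\to+\infty$, and that $(\ast_r)$ undergoes a rate-induced tipping at $r=r_0\in(0,\infty)$ with respect to $X^s$ if $x^r_-$ end-point tracks $X^s$ for all $r\in(0,r_0)$ and $x^{r_0}_-$ does not. Denote by $x(\cdot,s,x_0)$ the solution of $(\ast_r)$ with value $x_0$ at time $s$. A solution $\tilde x:[t_0,\infty)\to\mathbb R$ is uniformly stable if for every $\varepsilon>0$ there is $\delta>0$ such that $|\tilde x(s)-x_0|<\delta$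 with $s>t_0$ implies that $x(t,s,x_0)$ exists and $|\tilde x(t)-x(t,s,x_0)|<\varepsilon$ for all $t>s$. It is uniformly asymptotically stable if moreover there is $b>0$ such that for every $\varepsilon>0$ there is $T>0$ such that $|\tilde x(s)-x_0|<b$ with $s>t_0$ implies that $x(t,s,x_0)$ exists for all $t>s$ and $|\tilde x(t)-x(t,s,x_0)|<\varepsilon$ for all $t>s+T$. The solution $x^r_-$ is called uniformly asymptotically stable if it is defined on all of $\mathbb R$ and its restriction to some half-line $[t_0,\infty)$ is so. Let $$r^*=\sup\{r>0\mid x^\rho_-\text{ is uniformly asymptotically stable for all }0<\rho\le r\}\in[-\infty,\infty].$$ Then $x^r_-$ end-point tracks $X^s$ for all $0<r<r^*$. Moreover, the following are equivalent: (i) $r^*<\infty$; (ii) $0<r^*<\infty$, $x^{r^*}_-$ is defined on all of $\mathbb R$, is not uniformly asymptotically stable and does not end-point track $X^s$; and $(\ast_r)$ undergoes a rate-induced tipping at $r=r^*$ with respect to $X^s$; (iii) $0<r^*<\infty$ and there is an unstable hyperbolic equilibrium $X^u_+$ of $\dot x=f(x,\lambda_+)$ such that $x^{r^*}_-$ and $x^{r^*}_+$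 are defined on all of $\mathbb R$ and $x^{r^*}_-(t)=x^{r^*}_+(t)$ for all $t\in\mathbb R$; (iii′) there are an unstable hyperbolic equilibrium $X^u_+$ of $\dot x=f(x,\lambda_+)$ and some $r>0$ such that $x^{r}_-$ and $x^{r}_+$ are defined on all of $\mathbb R$ and coincide there. -/

import Mathlib

open Filter Topology Set

namespace RateTipping

/-- `X` is an equilibrium of the autonomous scalar equation `x' = f(x, l)`. -/
def IsEquilibrium (f : ℝ → ℝ → ℝ) (l X : ℝ) : Prop :=
  f X l = 0

/-- `X` is a stable hyperbolic equilibrium of `x' = f(x, l)`. -/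
def IsStableHyperbolic (f : ℝ → ℝ → ℝ) (l X : ℝ) : Prop :=
  IsEquilibrium f l X ∧ deriv (fun x => f x l) X < 0

/-- `X` is an unstable hyperbolic equilibrium of `x' = f(x, l)`. -/
def IsUnstableHyperbolic (f : ℝ → ℝ → ℝ) (l X : ℝ) : Prop :=
  IsEquilibrium f l X ∧ 0 < deriv (fun x => f x l) X

/-- The standing assumptions on the vector field `f`, the parameter interval `[lm, lp]`, the
family `Xs` of quasi-static stable equilibria and the parameter shift `L`. -/
structure StandingAssumptions (f : ℝ → ℝ → ℝ) (lm lp : ℝ) (Xs L : ℝ → ℝ) : Prop where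
  contDiff_f : ContDiff ℝ 2 (fun p : ℝ × ℝ => f p.1 p.2)
  bounded_f : ∃ M : ℝ, ∀ x l, |f x l| ≤ M
  hyperbolic : ∃ S : Set ℝ, S.Finite ∧ S ⊆ Ioo lm lp ∧
    ∀ l ∈ Icc lm lp \ S, ∀ x, IsEquilibrium f l x → deriv (fun y => f y l) x ≠ 0
  continuousOn_Xs : ContinuousOn Xs (Icc lm lp)
  stable_Xs : ∀ l ∈ Icc lm lp, IsStableHyperbolic f l (Xs l)
  contDiff_L : ContDiff ℝ 2 L
  mapsTo_L : ∀ t, L t ∈ Icc lm lp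
  strictMono_L : StrictMono L
  tendsto_L_atBot : Tendsto L atBot (𝓝 lm)
  tendsto_L_atTop : Tendsto L atTop (𝓝 lp)
  tendsto_deriv_L_atBot : Tendsto (deriv L) atBot (𝓝 0)
  tendsto_deriv_L_atTop : Tendsto (deriv L) atTop (𝓝 0)
  uniformly_stable_Xs : ∃ p : ℝ, 0 < p ∧ ∀ t, deriv (fun x => f x (L t)) (Xs (L t)) < -p

/-- No equilibrium of `x' = f(x, l)` escapes to infinity as `l` increases to `lp`: for all `l` in
one common interval `[l0, lp]` there are points arbitrarily far to the right, and arbitrarily far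
to the left, which are never equilibria. -/
def NoEquilibriumFromInfinity (f : ℝ → ℝ → ℝ) (lm lp : ℝ) : Prop :=
  ∃ l0 ∈ Ico lm lp,
    (∀ R : ℝ, ∃ K, R ≤ K ∧ ∀ l ∈ Icc l0 lp, ¬ IsEquilibrium f l K) ∧
    (∀ R : ℝ, ∃ K, K ≤ R ∧ ∀ l ∈ Icc l0 lp, ¬ IsEquilibrium f l K)

/-- The nonautonomous vector field `(t, x) ↦ f(x, L(r t))`. -/
def shiftField (f : ℝ → ℝ → ℝ) (L : ℝ → ℝ) (r : ℝ) : ℝ → ℝ → ℝ :=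
  fun t x => f x (L (r * t))

/-- The open half-line `(-∞, b)`, with `b ≤ ∞`. -/
def leftRay (b : EReal) : Set ℝ := {t | (t : EReal) < b}

/-- The open half-line `(a, ∞)`, with `a ≥ -∞`. -/
def rightRay (a : EReal) : Set ℝ := {t | a < (t : EReal)}

/-- `x` is a solution of `x' = v(t, x)` on `(-∞, b)` with limit `X` at `-∞`. -/
def EmanatesFrom (v : ℝ → ℝ → ℝ) (X : ℝ) (b : EReal) (x : ℝ → ℝ) : Prop :=
  ⊥ < b ∧ IsIntegralCurveOn x v (leftRay b) ∧ Tendsto x atBot (𝓝 X)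

/-- `x` is a solution of `x' = v(t, x)` on `(a, ∞)` with limit `X` at `+∞`. -/
def LandsAt (v : ℝ → ℝ → ℝ) (X : ℝ) (a : EReal) (x : ℝ → ℝ) : Prop :=
  a < ⊤ ∧ IsIntegralCurveOn x v (rightRay a) ∧ Tendsto x atTop (𝓝 X)

/-- `x`, on its maximal interval `(-∞, b)`, is the solution of `x' = v(t, x)` with limit `X` at
`-∞`: every other such solution is a restriction of it. For `v = shiftField f L r` and `X` the
stable hyperbolic equilibrium of the past limit problem, this is the (locally) pullback attracting
solution. Values of `x` outside `(-∞, b)` are irrelevant. -/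
def IsPullbackAttractor (v : ℝ → ℝ → ℝ) (X : ℝ) (b : EReal) (x : ℝ → ℝ) : Prop :=
  EmanatesFrom v X b x ∧
    ∀ (c : EReal) (y : ℝ → ℝ), EmanatesFrom v X c y → c ≤ b ∧ EqOn y x (leftRay c)

/-- `x`, on its maximal interval `(a, ∞)`, is the solution of `x' = v(t, x)` with limit `X` at
`+∞`: every other such solution is a restriction of it. For `v = shiftField f L r` and `X` an
unstable hyperbolic equilibrium of the future limit problem, this is the (locally) pullback
repelling solution. -/
def IsPullbackRepeller (v : ℝ → ℝ → ℝ) (X : ℝ) (a : EReal) (x : ℝ → ℝ) : Prop :=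
  LandsAt v X a x ∧
    ∀ (c : EReal) (y : ℝ → ℝ), LandsAt v X c y → a ≤ c ∧ EqOn y x (rightRay c)

/-- `y` is the solution of `x' = v(t, x)` with `y(s) = x0`, and is defined on `[s, ∞)`. -/
def IsForwardSolution (v : ℝ → ℝ → ℝ) (s x0 : ℝ) (y : ℝ → ℝ) : Prop :=
  y s = x0 ∧ IsIntegralCurveOn y v (Ici s)

/-- Uniform stability of a solution `x : [t0, ∞) → ℝ` of `x' = v(t, x)`. -/
def IsUniformlyStable (v : ℝ → ℝ → ℝ) (t0 : ℝ) (x : ℝ → ℝ) : Prop :=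
  ∀ ε > 0, ∃ δ > 0, ∀ s > t0, ∀ x0, |x s - x0| < δ →
    ∃ y, IsForwardSolution v s x0 y ∧ ∀ t > s, |x t - y t| < ε

/-- Uniform asymptotic stability of a solution `x : [t0, ∞) → ℝ` of `x' = v(t, x)`. -/
def IsUniformlyAsymptoticallyStable (v : ℝ → ℝ → ℝ) (t0 : ℝ) (x : ℝ → ℝ) : Prop :=
  IsUniformlyStable v t0 x ∧
    ∃ b > 0, ∀ ε > 0, ∃ T > 0, ∀ s > t0, ∀ x0, |x s - x0| < b →
      ∃ y, IsForwardSolution v s x0 y ∧ ∀ t > s + T, |x t - y t| < ε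

/-- A solution `x` defined on `(-∞, b)` is uniformly asymptotically stable if it is globally
defined and its restriction to some half-line `[t0, ∞)` is uniformly asymptotically stable. -/
def IsUASOnRay (v : ℝ → ℝ → ℝ) (b : EReal) (x : ℝ → ℝ) : Prop :=
  b = ⊤ ∧ ∃ t0 : ℝ, IsUniformlyAsymptoticallyStable v t0 x

/-- A solution `x` defined on `(-∞, b)` end-point tracks the curve of quasi-static equilibria
whose equilibrium for the future limit problem is `Xp`. -/
def EndPointTracks (Xp : ℝ) (b : EReal) (x : ℝ → ℝ) : Prop :=
  b = ⊤ ∧ Tendsto x atTop (𝓝 Xp)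

/-- The critical rate: the supremum of all `r > 0` such that, for every `0 < ρ ≤ r`, the pullback
attracting solution emanating from `Xm` is uniformly asymptotically stable. -/
noncomputable def criticalRate (f : ℝ → ℝ → ℝ) (L : ℝ → ℝ) (Xm : ℝ) : EReal :=
  sSup ((fun r : ℝ => (r : EReal)) '' {r : ℝ | 0 < r ∧ ∀ ρ : ℝ, 0 < ρ → ρ ≤ r →
    ∃ b x, IsPullbackAttractor (shiftField f L ρ) Xm b x ∧ IsUASOnRay (shiftField f L ρ) b x})

/-- `x' = f(x, L(r t))` undergoes a rate-induced tipping at `rs` (with respect to a curve of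
quasi-static equilibria with end-points `Xm`, `Xp`): the pullback attracting solution emanating
from `Xm` end-point tracks the curve for all rates in `(0, rs)`, but does not at the rate `rs`. -/
def RateInducedTippingAt (f : ℝ → ℝ → ℝ) (L : ℝ → ℝ) (Xm Xp rs : ℝ) : Prop :=
  0 < rs ∧
    (∀ r : ℝ, 0 < r → r < rs →
      ∃ b x, IsPullbackAttractor (shiftField f L r) Xm b x ∧ EndPointTracks Xp b x) ∧
    ∃ b x, IsPullbackAttractor (shiftField f L rs) Xm b x ∧ ¬ EndPointTracks Xp b x

/-- At the rate `r`, the pullback attracting solution emanating from `Xm` and the pullback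
repelling solution landing at `Xu` are both defined on all of `ℝ` and coincide. -/
def CollideAt (f : ℝ → ℝ → ℝ) (L : ℝ → ℝ) (Xm Xu r : ℝ) : Prop :=
  ∃ b x a y, IsPullbackAttractor (shiftField f L r) Xm b x ∧
    IsPullbackRepeller (shiftField f L r) Xu a y ∧ b = ⊤ ∧ a = ⊥ ∧ ∀ t : ℝ, x t = y t

end RateTipping

namespace RateTipping

/-! Since `f` is bounded, every solution is global. The pullback attractor therefore always lives on
all of `ℝ`, and only its behaviour at `+∞` matters. The future limit problem is scalar and
autonomous with only hyperbolic equilibria, so a solution tends to `+∞`, to `-∞`, or to a stable or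
unstable equilibrium.

The core is `future_trichotomy`, a statement about openness in the rate. If the emanating solution
tends to a stable equilibrium, nearby rates give the same limit. If it diverges, nearby rates fail
to track, because a level free of equilibria far out acts as a one-way barrier; this is where
`NoEquilibriumFromInfinity` enters. The remaining case, an unstable limit, is incompatible with
uniform asymptotic stability. Openness rests on continuity in the rate (`eventually_close`),
obtained by comparing solutions in the rescaled time `r * t`.

Uniform asymptotic stability alone does not force tracking, as the limit could be another
equilibrium or infinity. But on an interval of stable rates, tracking and non-tracking are both
open, and slow rates do track (`exists_forall_lt_tendsto`), so connectedness gives tracking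
throughout. At a finite critical rate a stable limit would push the supremum further, and divergence
would destroy tracking just below. Hence the limit is unstable, and the attractor is also the
repeller there. Conversely, a collision at any rate makes that rate unstable and so bounds the
critical rate. -/

/-- A time-dependent scalar vector field that is continuous in time, bounded, and Lipschitz in
space on bounded sets. -/
structure IsTameField (v : ℝ → ℝ → ℝ) : Prop where
  continuous_time : ∀ x, Continuous (fun t => v t x)
  bounded : ∃ M : ℝ, ∀ t x, |v t x| ≤ M
  lipschitz : ∀ R : ℝ, ∃ K : NNReal, ∀ t ∈ Icc (-R) R, LipschitzOnWith K (v t) (Icc (-R) R)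

/-! ### Scalar equations: global existence, comparison, limits at infinity -/

section General

variable {v : ℝ → ℝ → ℝ} {x y : ℝ → ℝ} {a b : ℝ}

theorem IsTameField.exists_lipschitz (hv : IsTameField v)
    (hx : IsIntegralCurveOn x v (Icc a b)) (hy : IsIntegralCurveOn y v (Icc a b)) :
    ∃ (K : NNReal) (R : ℝ), (∀ t ∈ Icc a b, LipschitzOnWith K (v t) (Icc (-R) R)) ∧
      (∀ t ∈ Icc a b, x t ∈ Icc (-R) R) ∧ ∀ t ∈ Icc a b, y t ∈ Icc (-R) R := by
  obtain ⟨C, hC⟩ := isCompact_Icc.exists_bound_of_continuousOn hx.continuousOn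
  obtain ⟨D, hD⟩ := isCompact_Icc.exists_bound_of_continuousOn hy.continuousOn
  set R := max (max C D) (max |a| |b|)
  obtain ⟨K, hK⟩ := hv.lipschitz R
  refine ⟨K, R, fun t ht => hK t ?_, fun t ht => ?_, fun t ht => ?_⟩
  · have h1 : |a| ≤ R := (le_max_left _ _).trans (le_max_right _ _)
    have h2 : |b| ≤ R := (le_max_right _ _).trans (le_max_right _ _)
    exact ⟨(abs_le.1 h1).1.trans ht.1, ht.2.trans (abs_le.1 h2).2⟩
  · exact abs_le.1 ((hC t ht).trans ((le_max_left _ _).trans (le_max_left _ _)))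
  · exact abs_le.1 ((hD t ht).trans ((le_max_right _ _).trans (le_max_left _ _)))

theorem IsTameField.eqOn (hv : IsTameField v) {s : Set ℝ} (hs : s.OrdConnected)
    (hx : IsIntegralCurveOn x v s) (hy : IsIntegralCurveOn y v s) {t₀ : ℝ} (ht₀ : t₀ ∈ s)
    (h : x t₀ = y t₀) : EqOn x y s := by
  intro t ht
  rcases le_total t₀ t with hle | hle
  · have hsub := hs.out ht₀ ht
    have hx' := hx.mono hsub
    have hy' := hy.mono hsub
    obtain ⟨K, R, hK, hxR, hyR⟩ := hv.exists_lipschitz hx' hy'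
    refine ODE_solution_unique_of_mem_Icc_right (s := fun _ => Icc (-R) R)
      (fun u hu => hK u (Ico_subset_Icc_self hu)) hx'.continuousOn (fun u hu => ?_)
      (fun u hu => hxR u (Ico_subset_Icc_self hu)) hy'.continuousOn (fun u hu => ?_)
      (fun u hu => hyR u (Ico_subset_Icc_self hu)) h ⟨hle, le_rfl⟩
    · exact (hx' u (Ico_subset_Icc_self hu)).mono_of_mem_nhdsWithin (Icc_mem_nhdsGE_of_mem hu)
    · exact (hy' u (Ico_subset_Icc_self hu)).mono_of_mem_nhdsWithin (Icc_mem_nhdsGE_of_mem hu)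
  · have hsub := hs.out ht ht₀
    have hx' := hx.mono hsub
    have hy' := hy.mono hsub
    obtain ⟨K, R, hK, hxR, hyR⟩ := hv.exists_lipschitz hx' hy'
    refine ODE_solution_unique_of_mem_Icc_left (s := fun _ => Icc (-R) R)
      (fun u hu => hK u (Ioc_subset_Icc_self hu)) hx'.continuousOn (fun u hu => ?_)
      (fun u hu => hxR u (Ioc_subset_Icc_self hu)) hy'.continuousOn (fun u hu => ?_)
      (fun u hu => hyR u (Ioc_subset_Icc_self hu)) h ⟨le_rfl, hle⟩
    · exact (hx' u (Ioc_subset_Icc_self hu)).mono_of_mem_nhdsWithin (Icc_mem_nhdsLE_of_mem hu)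
    · exact (hy' u (Ioc_subset_Icc_self hu)).mono_of_mem_nhdsWithin (Icc_mem_nhdsLE_of_mem hu)

/-- With speed at most `M`, a solution moves at most `M * n` in time `n`, so Picard–Lindelöf on the
ball of radius `M * n` imposes no smallness on `n`. The Lipschitz constant is taken on a square
containing both the time interval and that ball. -/
theorem IsTameField.exists_local (hv : IsTameField v) (t₀ x₀ : ℝ) (n : ℕ) :
    ∃ α : ℝ → ℝ, α t₀ = x₀ ∧ IsIntegralCurveOn α v (Icc (t₀ - n) (t₀ + n)) := by
  obtain ⟨M, hM⟩ := hv.bounded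
  have hM0 : 0 ≤ M := (abs_nonneg _).trans (hM 0 0)
  have hn : (0 : ℝ) ≤ n := n.cast_nonneg
  set R := max (|t₀| + n) (|x₀| + M * n)
  obtain ⟨K, hK⟩ := hv.lipschitz R
  have hR1 : |t₀| + n ≤ R := le_max_left _ _
  have hR2 : |x₀| + M * n ≤ R := le_max_right _ _
  have ht1 := neg_abs_le t₀
  have ht2 := le_abs_self t₀
  have hx1 := neg_abs_le x₀
  have hx2 := le_abs_self x₀
  have hpl : IsPicardLindelof v (tmin := t₀ - n) (tmax := t₀ + n)
      ⟨t₀, by constructor <;> linarith⟩ x₀ ⟨M * n, by positivity⟩ 0 ⟨M, hM0⟩ K := by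
    refine ⟨fun t ht => (hK t ?_).mono ?_, fun x _ => (hv.continuous_time x).continuousOn,
      fun t _ x _ => hM t x, ?_⟩
    · exact ⟨by linarith [ht.1], by linarith [ht.2]⟩
    · intro z hz
      rw [Metric.mem_closedBall, Real.dist_eq] at hz
      change |z - x₀| ≤ M * n at hz
      rw [abs_le] at hz
      exact ⟨by linarith [hz.1], by linarith [hz.2]⟩
    · change M * max (t₀ + n - t₀) (t₀ - (t₀ - n)) ≤ M * n - 0
      simp
  exact hpl.exists_eq_forall_mem_Icc_hasDerivWithinAt₀

theorem IsTameField.exists_isIntegralCurve (hv : IsTameField v) (t₀ x₀ : ℝ) :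
    ∃ x : ℝ → ℝ, x t₀ = x₀ ∧ IsIntegralCurve x v := by
  choose α hα0 hα using hv.exists_local t₀ x₀
  have key : ∀ m n : ℕ, ∀ t, |t - t₀| ≤ m → |t - t₀| ≤ n → α m t = α n t := by
    have aux : ∀ m n : ℕ, m ≤ n → ∀ t, |t - t₀| ≤ m → α m t = α n t := by
      intro m n hmn t ht
      have hmn' : (m : ℝ) ≤ n := by exact_mod_cast hmn
      have hm : (0 : ℝ) ≤ m := m.cast_nonneg
      refine hv.eqOn ordConnected_Icc (hα m)
        ((hα n).mono (Icc_subset_Icc (by linarith) (by linarith)))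
        (t₀ := t₀) ⟨by linarith, by linarith⟩ (by rw [hα0, hα0]) ?_
      rw [abs_le] at ht
      exact ⟨by linarith [ht.1], by linarith [ht.2]⟩
    intro m n t hm hn
    rcases le_total m n with h | h
    · exact aux m n h t hm
    · exact (aux n m h t hn).symm
  have hN : ∀ t, |t - t₀| < ((⌈|t - t₀|⌉₊ + 1 : ℕ) : ℝ) := fun t => by
    push_cast
    linarith [Nat.le_ceil |t - t₀|]
  -- The `+ 1` puts `t` strictly inside the domain of its piece, so that one piece describes the
  -- glued function near `t`.
  refine ⟨fun t => α (⌈|t - t₀|⌉₊ + 1) t, hα0 _, fun t => ?_⟩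
  set n := ⌈|t - t₀|⌉₊ + 1 with hn
  have hlt : |t - t₀| < (n : ℝ) := hN t
  have hev : (fun s => α (⌈|s - t₀|⌉₊ + 1) s) =ᶠ[𝓝 t] α n := by
    have : ∀ᶠ s in 𝓝 t, |s - t₀| < n :=
      (by fun_prop : Continuous fun s : ℝ => |s - t₀|).continuousAt.eventually_lt
        continuousAt_const hlt
    filter_upwards [this] with s hs
    exact key _ _ s (hN s).le hs.le
  rw [abs_lt] at hlt
  exact ((hα n t ⟨by linarith, by linarith⟩).hasDerivAt
    (Icc_mem_nhds (by linarith) (by linarith))).congr_of_eventuallyEq hev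

/-- Backward stability of solutions with respect to their terminal values. -/
theorem abs_sub_le_exp_mul {K : ℝ} (hab : a ≤ b)
    (hx : IsIntegralCurveOn x v (Icc a b)) (hy : IsIntegralCurveOn y v (Icc a b))
    (hK : ∀ t ∈ Icc a b, |v t (x t) - v t (y t)| ≤ K * |x t - y t|) :
    |x a - y a| ≤ Real.exp (K * (b - a)) * |x b - y b| := by
  -- Squaring the weighted difference avoids differentiating an absolute value.
  have hmono : MonotoneOn (fun t => (Real.exp (K * t) * (x t - y t)) ^ 2) (Icc a b) := by
    have hd : ∀ t ∈ interior (Icc a b), HasDerivAt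
        (fun t => (Real.exp (K * t) * (x t - y t)) ^ 2)
        (2 * Real.exp (K * t) ^ 2 * (x t - y t) *
          (K * (x t - y t) + (v t (x t) - v t (y t)))) t := by
      intro t ht
      have htI := interior_subset ht
      have hn : Icc a b ∈ 𝓝 t := mem_interior_iff_mem_nhds.1 ht
      have h1 := (hx t htI).hasDerivAt hn
      have h2 := (hy t htI).hasDerivAt hn
      have h3 : HasDerivAt (fun t => Real.exp (K * t)) (Real.exp (K * t) * (K * 1)) t :=
        ((hasDerivAt_id t).const_mul K).exp
      convert! (h3.mul (h1.sub h2)).pow 2 using 1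
      simp only [Pi.sub_apply, Pi.mul_apply]
      push_cast
      ring
    refine monotoneOn_of_deriv_nonneg (convex_Icc a b) ?_
      (fun t ht => (hd t ht).differentiableAt.differentiableWithinAt) (fun t ht => ?_)
    · exact (((by fun_prop : Continuous fun t => Real.exp (K * t)).continuousOn).mul
        (hx.continuousOn.sub hy.continuousOn)).pow 2
    · rw [(hd t ht).deriv]
      have h1 := hK t (interior_subset ht)
      have h2 : -(K * (x t - y t) ^ 2) ≤ (x t - y t) * (v t (x t) - v t (y t)) := by
        have h3 : |(x t - y t) * (v t (x t) - v t (y t))| ≤ K * (x t - y t) ^ 2 := by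
          rw [abs_mul, ← sq_abs (x t - y t)]
          nlinarith [abs_nonneg (x t - y t)]
        exact (abs_le.1 h3).1
      have h4 : 0 ≤ Real.exp (K * t) ^ 2 := by positivity
      nlinarith
  have h := hmono ⟨le_rfl, hab⟩ ⟨hab, le_rfl⟩ hab
  simp only at h
  have h' := sq_le_sq.1 h
  rw [abs_mul, abs_mul, abs_of_pos (Real.exp_pos _), abs_of_pos (Real.exp_pos _)] at h'
  have h3 : Real.exp (K * (b - a)) = Real.exp (K * b) / Real.exp (K * a) := by
    rw [← Real.exp_sub]; ring_nf
  rw [h3, div_mul_eq_mul_div, le_div_iff₀ (Real.exp_pos _)]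
  linarith

/-- Two differentiable functions cannot cross in the wrong direction. -/
theorem le_of_deriv_lt_of_eq {f g f' g' : ℝ → ℝ}
    (hf : ∀ t ∈ Icc a b, HasDerivWithinAt f (f' t) (Icc a b) t)
    (hg : ∀ t ∈ Icc a b, HasDerivWithinAt g (g' t) (Icc a b) t) (ha : f a ≤ g a)
    (h : ∀ t ∈ Ico a b, f t = g t → f' t < g' t) : ∀ t ∈ Icc a b, f t ≤ g t := fun _ ht =>
  image_le_of_deriv_right_lt_deriv_boundary' (fun t ht => (hf t ht).continuousWithinAt)
    (fun t ht => (hf t (Ico_subset_Icc_self ht)).mono_of_mem_nhdsWithin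
      (Icc_mem_nhdsGE_of_mem ht)) ha (fun t ht => (hg t ht).continuousWithinAt)
    (fun t ht => (hg t (Ico_subset_Icc_self ht)).mono_of_mem_nhdsWithin
      (Icc_mem_nhdsGE_of_mem ht)) h ht

theorem le_const_of_neg {c : ℝ} (hx : IsIntegralCurveOn x v (Icc a b)) (ha : x a ≤ c)
    (h : ∀ t ∈ Ico a b, v t c < 0) : ∀ t ∈ Icc a b, x t ≤ c :=
  le_of_deriv_lt_of_eq hx (fun t _ => hasDerivWithinAt_const t _ c) ha
    (fun t ht he => by rw [he]; exact h t ht)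

theorem const_le_of_pos {c : ℝ} (hx : IsIntegralCurveOn x v (Icc a b)) (ha : c ≤ x a)
    (h : ∀ t ∈ Ico a b, 0 < v t c) : ∀ t ∈ Icc a b, c ≤ x t :=
  le_of_deriv_lt_of_eq (fun t _ => hasDerivWithinAt_const t _ c) hx ha
    (fun t ht he => by rw [← he]; exact h t ht)

/-- Solutions in a region where the field is strictly decreasing do not drift apart. -/
theorem abs_sub_le_of_strictAntiOn {ε : ℝ} {S : Set ℝ} (hε : 0 < ε)
    (hx : IsIntegralCurveOn x v (Icc a b)) (hy : IsIntegralCurveOn y v (Icc a b))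
    (hxS : ∀ t ∈ Icc a b, x t ∈ S) (hyS : ∀ t ∈ Icc a b, y t ∈ S)
    (hv : ∀ t ∈ Ico a b, StrictAntiOn (v t) S) (ha : |x a - y a| ≤ ε) :
    ∀ t ∈ Icc a b, |x t - y t| ≤ ε := by
  intro t ht
  rw [abs_le] at ha ⊢
  have h1 := le_of_deriv_lt_of_eq hx (fun t ht => (hy t ht).add_const ε) (by linarith [ha.2])
    (fun t ht he => hv t ht (hyS t (Ico_subset_Icc_self ht)) (hxS t (Ico_subset_Icc_self ht))
      (by rw [he]; linarith)) t ht
  have h2 := le_of_deriv_lt_of_eq hy (fun t ht => (hx t ht).add_const ε) (by linarith [ha.1])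
    (fun t ht he => hv t ht (hxS t (Ico_subset_Icc_self ht)) (hyS t (Ico_subset_Icc_self ht))
      (by rw [he]; linarith)) t ht
  constructor <;> linarith

/-- Solutions in a region where the field is strictly increasing do not approach each other. -/
theorem add_le_of_strictMonoOn {δ : ℝ} {S : Set ℝ} (hδ : 0 < δ)
    (hx : IsIntegralCurveOn x v (Icc a b)) (hy : IsIntegralCurveOn y v (Icc a b))
    (hxS : ∀ t ∈ Icc a b, x t ∈ S) (hyS : ∀ t ∈ Icc a b, y t ∈ S)
    (hv : ∀ t ∈ Ico a b, StrictMonoOn (v t) S) (ha : x a + δ ≤ y a) :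
    ∀ t ∈ Icc a b, x t + δ ≤ y t :=
  le_of_deriv_lt_of_eq (fun t ht => (hx t ht).add_const δ) hy ha
    (fun t ht he => hv t ht (hxS t (Ico_subset_Icc_self ht)) (hyS t (Ico_subset_Icc_self ht))
      (by rw [← he]; linarith))

/-- At a non-equilibrium level of the limit equation the field eventually has a fixed sign, so the
level can be crossed in one direction only. -/
theorem eventually_ge_or_le {c d : ℝ} (hx : IsIntegralCurveOn x v (Ici a))
    (hd : Tendsto (fun t => v t c) atTop (𝓝 d)) (h0 : d ≠ 0) :
    (∀ᶠ t in atTop, c ≤ x t) ∨ ∀ᶠ t in atTop, x t ≤ c := by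
  rcases lt_or_gt_of_ne h0 with h | h
  · obtain ⟨T, hT⟩ := ((hd.eventually_lt_const h).and (eventually_ge_atTop a)).exists_forall_of_atTop
    by_cases hex : ∃ t ≥ T, x t ≤ c
    · obtain ⟨t, ht, hc⟩ := hex
      refine Or.inr (eventually_atTop.2 ⟨t, fun s hs => ?_⟩)
      exact le_const_of_neg (hx.mono (fun u hu => (hT t ht).2.trans hu.1)) hc
        (fun u hu => (hT u (ht.trans hu.1)).1) s ⟨hs, le_rfl⟩
    · push Not at hex
      exact Or.inl (eventually_atTop.2 ⟨T, fun s hs => (hex s hs).le⟩)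
  · obtain ⟨T, hT⟩ := ((hd.eventually_const_lt h).and (eventually_ge_atTop a)).exists_forall_of_atTop
    by_cases hex : ∃ t ≥ T, c ≤ x t
    · obtain ⟨t, ht, hc⟩ := hex
      refine Or.inl (eventually_atTop.2 ⟨t, fun s hs => ?_⟩)
      exact const_le_of_pos (hx.mono (fun u hu => (hT t ht).2.trans hu.1)) hc
        (fun u hu => (hT u (ht.trans hu.1)).1) s ⟨hs, le_rfl⟩
    · push Not at hex
      exact Or.inr (eventually_atTop.2 ⟨T, fun s hs => (hex s hs).le⟩)

/-- A solution of an asymptotically autonomous scalar equation has a limit in `[-∞, ∞]`. -/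
theorem tendsto_atTop_or_atBot_or_nhds {h : ℝ → ℝ} (hx : IsIntegralCurveOn x v (Ici a))
    (hh : ∀ c, Tendsto (fun t => v t c) atTop (𝓝 (h c))) (hdense : Dense {c | h c ≠ 0}) :
    Tendsto x atTop atTop ∨ Tendsto x atTop atBot ∨ ∃ l, Tendsto x atTop (𝓝 l) := by
  have key := fun c (hc : h c ≠ 0) => eventually_ge_or_le hx (hh c) hc
  -- The limit is the supremum of the levels eventually below `x`. Density supplies non-equilibrium
  -- levels, for which `key` decides the side.
  set S := {c | ∀ᶠ t in atTop, c ≤ x t} with hS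
  have hdown : ∀ c ∈ S, ∀ d ≤ c, d ∈ S := fun c hc d hd => by
    filter_upwards [hc] with t ht using hd.trans ht
  rcases S.eq_empty_or_nonempty with hE | hne
  · refine Or.inr (Or.inl (tendsto_atBot.2 fun R => ?_))
    obtain ⟨c, hc, hcR⟩ := hdense.exists_lt R
    rcases key c hc with h1 | h1
    · exact absurd (show c ∈ S from h1) (by simp [hE])
    · filter_upwards [h1] with t ht using ht.trans hcR.le
  by_cases hbd : BddAbove S
  · refine Or.inr (Or.inr ⟨sSup S, tendsto_order.2 ⟨fun d hd => ?_, fun d hd => ?_⟩⟩)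
    · obtain ⟨c, hc, hdc⟩ := exists_lt_of_lt_csSup hne hd
      filter_upwards [hc] with t ht using hdc.trans_le ht
    · obtain ⟨c, hc, h1, h2⟩ := hdense.exists_between hd
      rcases key c hc with h3 | h3
      · exact absurd (le_csSup hbd (show c ∈ S from h3)) (not_le.2 h1)
      · filter_upwards [h3] with t ht using ht.trans_lt h2
  · refine Or.inl (tendsto_atTop.2 fun R => ?_)
    obtain ⟨c, hc, hRc⟩ := not_bddAbove_iff.1 hbd R
    exact hdown c hc R hRc.le

/-- A limit of a solution of an asymptotically autonomous equation is an equilibrium. -/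
theorem eq_zero_of_tendsto {l d : ℝ} (hx : IsIntegralCurveOn x v (Ici a))
    (hl : Tendsto x atTop (𝓝 l)) (hd : Tendsto (fun t => v t (x t)) atTop (𝓝 d)) : d = 0 := by
  by_contra h0
  have hpos : 0 < |d| := abs_pos.2 h0
  have h1 : ∀ᶠ t in atTop, |x t - l| < |d| / 8 :=
    (Metric.tendsto_nhds.1 hl _ (by positivity))
  have h2 : ∀ᶠ t in atTop, |v t (x t) - d| < |d| / 2 :=
    (Metric.tendsto_nhds.1 hd _ (by positivity))
  obtain ⟨T, hT⟩ := ((h1.and h2).and (eventually_ge_atTop a)).exists_forall_of_atTop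
  have hT' := hT T le_rfl
  -- By the mean value theorem the increment over unit time is within `|d| / 2` of `d`, yet
  -- convergence makes it smaller than `|d| / 4`.
  obtain ⟨u, hu, hu'⟩ := exists_hasDerivAt_eq_slope x (fun t => v t (x t)) (lt_add_one T)
    (hx.continuousOn.mono fun s hs => hT'.2.trans hs.1)
    (fun s hs => (hx s (hT'.2.trans hs.1.le)).hasDerivAt (Ici_mem_nhds (hT'.2.trans_lt hs.1)))
  have h3 := (hT u hu.1.le).1.2
  have h4 := (hT (T + 1) (by linarith)).1.1
  have h5 := hT'.1.1
  simp only [add_sub_cancel_left, div_one] at hu'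
  rw [hu'] at h3
  have h6 : |d| ≤ |x (T + 1) - x T - d| + |x (T + 1) - l| + |x T - l| := by
    have e : d = -(x (T + 1) - x T - d) + (x (T + 1) - l) - (x T - l) := by ring
    calc |d| = |-(x (T + 1) - x T - d) + (x (T + 1) - l) - (x T - l)| := by rw [← e]
      _ ≤ _ := (abs_sub _ _).trans (add_le_add_left ((abs_add_le _ _).trans (by rw [abs_neg])) _)
  linarith

end General
-- Solutions with an attracting limit at `-∞` or a repelling limit at `+∞`
section PullbackAbstract

variable {v : ℝ → ℝ → ℝ} {X η T₀ : ℝ}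

theorem mem_Icc_of_inward {x : ℝ → ℝ} {a b lo hi : ℝ}
    (hx : IsIntegralCurveOn x v (Icc a b)) (ha : x a ∈ Icc lo hi)
    (h : ∀ t ∈ Ico a b, v t hi < 0 ∧ 0 < v t lo) : ∀ t ∈ Icc a b, x t ∈ Icc lo hi :=
  fun t ht => ⟨const_le_of_pos hx ha.1 (fun s hs => (h s hs).2) t ht,
    le_const_of_neg hx ha.2 (fun s hs => (h s hs).1) t ht⟩

/-- Existence of a solution emanating at `-∞` from an attracting point. -/
theorem IsTameField.exists_tendsto_atBot (hv : IsTameField v) (hη : 0 < η)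
    (hanti : ∀ t ≤ T₀, StrictAntiOn (v t) (Icc (X - η) (X + η)))
    (hin : ∀ ε, 0 < ε → ε ≤ η → ∃ T, ∀ t ≤ T, v t (X + ε) < 0 ∧ 0 < v t (X - ε)) :
    ∃ x, IsIntegralCurve x v ∧ Tendsto x atBot (𝓝 X) := by
  choose! T hT using hin
  set T₁ := min T₀ (T η) with hT₁
  have hT₁0 : T₁ ≤ T₀ := min_le_left _ _
  have hT₁η : T₁ ≤ T η := min_le_right _ _
  -- Pullback construction: start at `X` at time `-n` and let `n` grow.
  choose z hz0 hz using fun n : ℕ => hv.exists_isIntegralCurve (-(n : ℝ)) X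
  have htube : ∀ ε, 0 < ε → ε ≤ η → ∀ n : ℕ, ∀ t, -(n : ℝ) ≤ t → t ≤ T ε →
      z n t ∈ Icc (X - ε) (X + ε) := by
    intro ε hε hεη n t hnt htT
    refine mem_Icc_of_inward ((hz n).isIntegralCurveOn (Icc (-(n : ℝ)) t)) ?_
      (fun s hs => hT ε hε hεη s (hs.2.le.trans htT)) t ⟨hnt, le_rfl⟩
    rw [hz0]; constructor <;> linarith
  -- At time `-n` the later-indexed solution is within `ε` of `X`, which is the value of `z n`
  -- there. Monotonicity of the field then keeps the gap from growing.
  have hcontr : ∀ ε, 0 < ε → ε ≤ η → ∀ n m : ℕ, n ≤ m → -(n : ℝ) ≤ T ε → -(n : ℝ) ≤ T₁ →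
      |z m T₁ - z n T₁| ≤ ε := by
    intro ε hε hεη n m hnm hn1 hn2
    have hnm' : -(m : ℝ) ≤ -n := by
      rw [neg_le_neg_iff]; exact_mod_cast hnm
    refine abs_sub_le_of_strictAntiOn hε ((hz m).isIntegralCurveOn (Icc (-(n : ℝ)) T₁))
      ((hz n).isIntegralCurveOn _)
      (fun t ht => htube η hη le_rfl m t (hnm'.trans ht.1) (ht.2.trans hT₁η))
      (fun t ht => htube η hη le_rfl n t ht.1 (ht.2.trans hT₁η))
      (fun t ht => hanti t (ht.2.le.trans hT₁0)) ?_ T₁ ⟨hn2, le_rfl⟩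
    have := htube ε hε hεη m (-(n : ℝ)) hnm' hn1
    rw [hz0, abs_le]
    exact ⟨by linarith [this.1], by linarith [this.2]⟩
  have hcauchy : CauchySeq fun n => z n T₁ := by
    refine Metric.cauchySeq_iff'.2 fun ε hε => ?_
    have hpos : 0 < min (ε / 2) η := lt_min (by positivity) hη
    obtain ⟨N, hN⟩ := exists_nat_ge (max (-(T (min (ε / 2) η))) (-T₁))
    refine ⟨N, fun n hn => ?_⟩
    have h := hcontr _ hpos (min_le_right _ _) N n hn
      (by linarith [(le_max_left _ _).trans hN]) (by linarith [(le_max_right _ _).trans hN])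
    rw [Real.dist_eq]
    linarith [h.trans (min_le_left _ _)]
  obtain ⟨ξ, hξ⟩ := cauchySeq_tendsto_of_complete hcauchy
  obtain ⟨x, hx0, hx⟩ := hv.exists_isIntegralCurve T₁ ξ
  -- Convergence at the single time `T₁` passes to earlier times by the backward exponential
  -- estimate.
  have hconv : ∀ t ≤ T₁, Tendsto (fun n => z n t) atTop (𝓝 (x t)) := by
    intro t ht
    obtain ⟨C, hC⟩ := isCompact_Icc.exists_bound_of_continuousOn
      (hx.continuous.continuousOn (s := Icc t T₁))
    set R := max C (max (|X| + η) (max |t| |T₁|))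
    have hR1 : C ≤ R := le_max_left _ _
    have hR2 : |X| + η ≤ R := (le_max_left _ _).trans (le_max_right _ _)
    have hR3 : |t| ≤ R := (le_max_left _ _).trans ((le_max_right _ _).trans (le_max_right _ _))
    have hR4 : |T₁| ≤ R := (le_max_right _ _).trans ((le_max_right _ _).trans (le_max_right _ _))
    obtain ⟨K, hK⟩ := hv.lipschitz R
    have hlim : Tendsto (fun n => Real.exp (K * (T₁ - t)) * |z n T₁ - x T₁|) atTop (𝓝 0) := by
      have h1 := tendsto_iff_dist_tendsto_zero.1 hξ
      simp only [Real.dist_eq] at h1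
      rw [hx0]
      simpa using h1.const_mul (Real.exp (K * (T₁ - t)))
    rw [tendsto_iff_dist_tendsto_zero]
    obtain ⟨N, hN⟩ := exists_nat_ge (-t)
    refine squeeze_zero' (Eventually.of_forall fun _ => dist_nonneg) ?_ hlim
    filter_upwards [eventually_ge_atTop N] with n hn
    have hn' : -(n : ℝ) ≤ t := by
      have : (N : ℝ) ≤ n := by exact_mod_cast hn
      linarith
    rw [Real.dist_eq]
    refine abs_sub_le_exp_mul ht ((hz n).isIntegralCurveOn _) (hx.isIntegralCurveOn _)
      (fun s hs => ?_)
    have h1 := htube η hη le_rfl n s (hn'.trans hs.1) (hs.2.trans hT₁η)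
    have h2 := hC s hs
    rw [Real.norm_eq_abs, abs_le] at h2
    have h3 := (hK s ⟨by linarith [(abs_le.1 hR3).1, hs.1], by linarith [(abs_le.1 hR4).2, hs.2]⟩)
    have h4 := h3.dist_le_mul (z n s)
      ⟨by linarith [neg_abs_le X, h1.1], by linarith [le_abs_self X, h1.2]⟩ (x s)
      ⟨by linarith, by linarith⟩
    rwa [Real.dist_eq, Real.dist_eq] at h4
  refine ⟨x, hx, Metric.tendsto_nhds.2 fun ε hε => ?_⟩
  have hpos : 0 < min (ε / 2) η := lt_min (by positivity) hη
  filter_upwards [eventually_le_atBot (min T₁ (T (min (ε / 2) η)))] with t ht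
  have hmem : x t ∈ Icc (X - min (ε / 2) η) (X + min (ε / 2) η) := by
    refine isClosed_Icc.mem_of_tendsto (hconv t (ht.trans (min_le_left _ _))) ?_
    obtain ⟨N, hN⟩ := exists_nat_ge (-t)
    filter_upwards [eventually_ge_atTop N] with n hn
    have hn' : -(n : ℝ) ≤ t := by
      have : (N : ℝ) ≤ n := by exact_mod_cast hn
      linarith
    exact htube _ hpos (min_le_right _ _) n t hn' (ht.trans (min_le_right _ _))
  rw [Real.dist_eq, abs_lt]
  have := min_le_left (ε / 2) η
  exact ⟨by linarith [hmem.1], by linarith [hmem.2]⟩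

theorem ordConnected_leftRay (b : EReal) : (leftRay b).OrdConnected :=
  ⟨fun _ _ _ hy _ hz => lt_of_le_of_lt (EReal.coe_le_coe_iff.2 hz.2) hy⟩

theorem ordConnected_rightRay (a : EReal) : (rightRay a).OrdConnected :=
  ⟨fun _ hx _ _ _ hz => lt_of_lt_of_le hx (EReal.coe_le_coe_iff.2 hz.1)⟩

theorem exists_Iic_subset_leftRay {b : EReal} (hb : ⊥ < b) : ∃ B : ℝ, Iic B ⊆ leftRay b := by
  obtain ⟨B, -, hB⟩ := EReal.lt_iff_exists_real_btwn.1 hb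
  exact ⟨B, fun t ht => lt_of_le_of_lt (EReal.coe_le_coe_iff.2 ht) hB⟩

theorem exists_Ici_subset_rightRay {a : EReal} (ha : a < ⊤) : ∃ A : ℝ, Ici A ⊆ rightRay a := by
  obtain ⟨A, hA, -⟩ := EReal.lt_iff_exists_real_btwn.1 ha
  exact ⟨A, fun t ht => lt_of_lt_of_le hA (EReal.coe_le_coe_iff.2 ht)⟩

theorem leftRay_top : leftRay ⊤ = univ := eq_univ_of_forall fun t => EReal.coe_lt_top t

/-- Two emanating solutions are arbitrarily close in the far past and cannot drift apart while the
field is decreasing, so they agree at one time and hence everywhere. -/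
theorem IsTameField.isPullbackAttractor (hv : IsTameField v) (hη : 0 < η)
    (hanti : ∀ t ≤ T₀, StrictAntiOn (v t) (Icc (X - η) (X + η))) {x : ℝ → ℝ}
    (hx : IsIntegralCurve x v) (hlim : Tendsto x atBot (𝓝 X)) :
    IsPullbackAttractor v X ⊤ x := by
  refine ⟨⟨bot_lt_top, hx.isIntegralCurveOn _, hlim⟩, fun c y ⟨hc, hy, hylim⟩ => ⟨le_top, ?_⟩⟩
  obtain ⟨B, hB⟩ := exists_Iic_subset_leftRay hc
  have hI : Icc (X - η) (X + η) ∈ 𝓝 X := Icc_mem_nhds (by linarith) (by linarith)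
  obtain ⟨T₁, hT₁⟩ := eventually_atBot.1 ((hlim.eventually_mem hI).and (hylim.eventually_mem hI))
  set T := min (min T₀ T₁) B
  have hTT : T ≤ T₀ := (min_le_left _ _).trans (min_le_left _ _)
  have hTT₁ : T ≤ T₁ := (min_le_left _ _).trans (min_le_right _ _)
  have hTB : T ≤ B := min_le_right _ _
  refine hv.eqOn (ordConnected_leftRay c) hy (hx.isIntegralCurveOn _) (hB hTB) ?_
  have hle : ∀ ε > 0, |y T - x T| ≤ ε := by
    intro ε hε
    have hd : ∀ᶠ t in atBot, |y t - x t| < ε := by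
      have := Metric.tendsto_nhds.1 (hylim.sub hlim) ε hε
      simpa [Real.dist_eq] using this
    obtain ⟨s, hs, hsT⟩ := (hd.and (eventually_le_atBot T)).exists
    exact abs_sub_le_of_strictAntiOn hε (hy.mono fun u hu => hB (hu.2.trans hTB))
      (hx.isIntegralCurveOn _) (fun t ht => (hT₁ t (ht.2.trans hTT₁)).2)
      (fun t ht => (hT₁ t (ht.2.trans hTT₁)).1) (fun t ht => hanti t (ht.2.le.trans hTT))
      hs.le T ⟨hsT, le_rfl⟩
  exact sub_eq_zero.1 (abs_nonpos_iff.1 (le_of_forall_pos_le_add fun ε hε => by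
    simpa using hle ε hε))

/-- Two solutions with the same repelling limit at `+∞` eventually coincide. -/
theorem eq_of_tendsto_repelling (hη : 0 < η)
    (hmono : ∀ t ≥ T₀, StrictMonoOn (v t) (Icc (X - η) (X + η))) {x y : ℝ → ℝ} {a : ℝ}
    (hx : IsIntegralCurveOn x v (Ici a)) (hxlim : Tendsto x atTop (𝓝 X))
    (hy : IsIntegralCurveOn y v (Ici a)) (hylim : Tendsto y atTop (𝓝 X)) :
    ∃ T ≥ a, x T = y T := by
  have hI : Icc (X - η) (X + η) ∈ 𝓝 X := Icc_mem_nhds (by linarith) (by linarith)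
  obtain ⟨T₁, hT₁⟩ := eventually_atTop.1 ((hxlim.eventually_mem hI).and (hylim.eventually_mem hI))
  set T := max (max T₀ T₁) a
  have hTT : T₀ ≤ T := (le_max_left _ _).trans (le_max_left _ _)
  have hTT₁ : T₁ ≤ T := (le_max_right _ _).trans (le_max_left _ _)
  have hTa : a ≤ T := le_max_right _ _
  refine ⟨T, hTa, ?_⟩
  -- A positive gap at `T` never shrinks where the field is increasing, contradicting the common
  -- limit.
  have aux : ∀ {x y : ℝ → ℝ}, IsIntegralCurveOn x v (Ici a) → IsIntegralCurveOn y v (Ici a) →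
      Tendsto x atTop (𝓝 X) → Tendsto y atTop (𝓝 X) →
      (∀ t ≥ T, x t ∈ Icc (X - η) (X + η)) → (∀ t ≥ T, y t ∈ Icc (X - η) (X + η)) →
      y T ≤ x T := by
    intro x y hx hy hxl hyl hxI hyI
    by_contra! hlt
    have hδ : 0 < y T - x T := sub_pos.2 hlt
    have hfar : ∀ t ≥ T, y T - x T ≤ y t - x t := fun t ht => by
      have := add_le_of_strictMonoOn hδ (hx.mono fun u (hu : u ∈ Icc T t) => hTa.trans hu.1)
        (hy.mono fun u hu => hTa.trans hu.1) (fun u hu => hxI u hu.1) (fun u hu => hyI u hu.1)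
        (fun u hu => hmono u (hTT.trans hu.1)) (by linarith) t ⟨ht, le_rfl⟩
      linarith
    have h0 : Tendsto (fun t => y t - x t) atTop (𝓝 0) := by simpa using hyl.sub hxl
    have := ge_of_tendsto h0 (eventually_atTop.2 ⟨T, hfar⟩)
    linarith
  exact le_antisymm
    (aux hy hx hylim hxlim (fun t ht => (hT₁ t (hTT₁.trans ht)).2)
      (fun t ht => (hT₁ t (hTT₁.trans ht)).1))
    (aux hx hy hxlim hylim (fun t ht => (hT₁ t (hTT₁.trans ht)).1)
      (fun t ht => (hT₁ t (hTT₁.trans ht)).2))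

theorem IsTameField.isPullbackRepeller (hv : IsTameField v) (hη : 0 < η)
    (hmono : ∀ t ≥ T₀, StrictMonoOn (v t) (Icc (X - η) (X + η))) {x : ℝ → ℝ}
    (hx : IsIntegralCurve x v) (hlim : Tendsto x atTop (𝓝 X)) :
    IsPullbackRepeller v X ⊥ x := by
  refine ⟨⟨bot_lt_top, hx.isIntegralCurveOn _, hlim⟩, fun c y ⟨hc, hy, hylim⟩ => ⟨bot_le, ?_⟩⟩
  obtain ⟨A, hA⟩ := exists_Ici_subset_rightRay hc
  obtain ⟨T, hT, hTe⟩ := eq_of_tendsto_repelling hη hmono (hy.mono hA) hylim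
    (hx.isIntegralCurveOn _) hlim
  exact hv.eqOn (ordConnected_rightRay c) hy (hx.isIntegralCurveOn _) (hA hT) hTe

/-- A solution landing at a repelling point is not uniformly asymptotically stable. -/
theorem IsTameField.not_isUniformlyAsymptoticallyStable (hv : IsTameField v) (hη : 0 < η)
    (hmono : ∀ t ≥ T₀, StrictMonoOn (v t) (Icc (X - η) (X + η))) {x : ℝ → ℝ}
    (hx : IsIntegralCurve x v) (hlim : Tendsto x atTop (𝓝 X)) (t₀ : ℝ) :
    ¬ IsUniformlyAsymptoticallyStable v t₀ x := by
  rintro ⟨-, b, hb, h⟩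
  have hs : t₀ + 1 > t₀ := by linarith
  have hxb : |x (t₀ + 1) - (x (t₀ + 1) + b / 2)| < b := by
    rw [sub_add_cancel_left, abs_neg, abs_of_pos (by positivity)]; linarith
  obtain ⟨_, _, h1⟩ := h 1 one_pos
  obtain ⟨y, ⟨hy0, hy⟩, -⟩ := h1 _ hs _ hxb
  -- Stability would draw the displaced solution `y` to the limit of `x`, which forces `y` and `x`
  -- to coincide. The witness `w` depends on `ε`; uniqueness identifies it with `y`.
  have hylim : Tendsto y atTop (𝓝 X) := by
    have hd : Tendsto (fun t => x t - y t) atTop (𝓝 0) := by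
      refine Metric.tendsto_nhds.2 fun ε hε => ?_
      obtain ⟨T, -, hT⟩ := h ε hε
      obtain ⟨w, ⟨hw0, hw⟩, hw'⟩ := hT _ hs _ hxb
      have hyw := hv.eqOn ordConnected_Ici hy hw self_mem_Ici (hy0.trans hw0.symm)
      filter_upwards [eventually_gt_atTop (t₀ + 1 + T), eventually_ge_atTop (t₀ + 1)] with t ht ht'
      rw [hyw ht', Real.dist_eq, sub_zero]
      exact hw' t ht
    simpa using hlim.sub hd
  obtain ⟨T, hT, hTe⟩ := eq_of_tendsto_repelling hη hmono (hx.isIntegralCurveOn _) hlim hy hylim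
  have := hv.eqOn ordConnected_Ici (hx.isIntegralCurveOn _) hy (mem_Ici.2 hT) hTe self_mem_Ici
  rw [hy0] at this
  linarith

end PullbackAbstract
/-- Fencing a solution by a tube of radius `E` around an approximate solution `w`. -/
theorem abs_sub_le_of_approx {v : ℝ → ℝ → ℝ} {x w w' E E' : ℝ → ℝ} {a b m : ℝ}
    (hx : IsIntegralCurveOn x v (Icc a b)) (hw : ∀ t ∈ Icc a b, HasDerivAt w (w' t) t)
    (hE : ∀ t ∈ Icc a b, HasDerivAt E (E' t) t)
    (hm : ∀ t ∈ Icc a b, |w' t - v t (w t)| ≤ m)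
    (h1 : ∀ t ∈ Icc a b, v t (w t + E t) - v t (w t) < E' t - m)
    (h2 : ∀ t ∈ Icc a b, v t (w t) - v t (w t - E t) < E' t - m)
    (ha : |x a - w a| ≤ E a) : ∀ t ∈ Icc a b, |x t - w t| ≤ E t := by
  intro t ht
  rw [abs_le] at ha ⊢
  have hu := le_of_deriv_lt_of_eq hx
    (fun t ht => ((hw t ht).add (hE t ht)).hasDerivWithinAt) (by simp only [Pi.add_apply]; linarith [ha.2])
    (fun s hs he => by
      have hs' := Ico_subset_Icc_self hs
      have hm' := abs_le.1 (hm s hs')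
      have h1' := h1 s hs'
      rw [he, Pi.add_apply]
      linarith [hm'.1]) t ht
  have hl := le_of_deriv_lt_of_eq
    (fun t ht => ((hw t ht).sub (hE t ht)).hasDerivWithinAt) hx (by simp only [Pi.sub_apply]; linarith [ha.1])
    (fun s hs he => by
      have hs' := Ico_subset_Icc_self hs
      have hm' := abs_le.1 (hm s hs')
      have h2' := h2 s hs'
      rw [← he, Pi.sub_apply]
      linarith [hm'.2]) t ht
  simp only [Pi.add_apply, Pi.sub_apply] at hu hl
  constructor <;> linarith

/-! ### Uniform contraction near stable equilibria -/

section Contraction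

variable {f : ℝ → ℝ → ℝ}

/-- Near `(Y, l₀)`, the field `f` is strictly decreasing in space at rate at least `q`. -/
def ContractsNear (f : ℝ → ℝ → ℝ) (q η Y l₀ : ℝ) : Prop :=
  ∀ l, |l - l₀| ≤ η → ∀ x ∈ Icc (Y - η) (Y + η), ∀ y ∈ Icc (Y - η) (Y + η), x ≤ y →
    f y l - f x l ≤ -q * (y - x)

theorem differentiable_fst (hf : ContDiff ℝ 2 (fun p : ℝ × ℝ => f p.1 p.2)) (l : ℝ) :
    Differentiable ℝ (fun x => f x l) := by
  have h : ContDiff ℝ 2 (fun x => f x l) := hf.comp (contDiff_id.prodMk contDiff_const)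
  exact h.differentiable two_ne_zero

theorem continuous_deriv_fst (hf : ContDiff ℝ 2 (fun p : ℝ × ℝ => f p.1 p.2)) :
    Continuous (fun p : ℝ × ℝ => deriv (fun x => f x p.2) p.1) := by
  have h : (fun p : ℝ × ℝ => deriv (fun x => f x p.2) p.1) =
      fun p => fderiv ℝ (fun p : ℝ × ℝ => f p.1 p.2) p (1, 0) := by
    funext p
    have h1 : HasFDerivAt (fun p : ℝ × ℝ => f p.1 p.2)
        (fderiv ℝ (fun p : ℝ × ℝ => f p.1 p.2) (p.1, p.2)) (p.1, p.2) :=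
      (hf.differentiable two_ne_zero (p.1, p.2)).hasFDerivAt
    have h2 : HasDerivAt (fun x : ℝ => (x, p.2)) ((1 : ℝ), (0 : ℝ)) p.1 :=
      (hasDerivAt_id p.1).prodMk (hasDerivAt_const _ _)
    exact (h1.comp_hasDerivAt p.1 h2).deriv
  rw [h]
  exact (hf.continuous_fderiv two_ne_zero).clm_apply continuous_const

/-- By compactness the negative sign survives on a closed thickening of `S`, where the derivative
attains a negative maximum; the mean value inequality then applies. In the sup metric the thickening
contains the boxes of half-width `η`. -/
theorem exists_contractsNear (hf : ContDiff ℝ 2 (fun p : ℝ × ℝ => f p.1 p.2)) {S : Set (ℝ × ℝ)}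
    (hS : IsCompact S) (hneg : ∀ p ∈ S, deriv (fun x => f x p.2) p.1 < 0) :
    ∃ q > 0, ∃ η > 0, ∀ p ∈ S, ContractsNear f q η p.1 p.2 := by
  have hc := continuous_deriv_fst hf
  obtain ⟨η, hη, hsub⟩ := hS.exists_cthickening_subset_open (isOpen_lt hc continuous_const) hneg
  have hcomp : IsCompact (Metric.cthickening η S) := hS.cthickening
  obtain ⟨q, hq, hqle⟩ : ∃ q > 0, ∀ p ∈ Metric.cthickening η S,
      deriv (fun x => f x p.2) p.1 ≤ -q := by
    rcases (Metric.cthickening η S).eq_empty_or_nonempty with he | hne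
    · exact ⟨1, one_pos, by simp [he]⟩
    · obtain ⟨p₀, hp₀, hmax⟩ := hcomp.exists_isMaxOn hne hc.continuousOn
      exact ⟨-deriv (fun x => f x p₀.2) p₀.1, neg_pos.2 (hsub hp₀), fun p hp => by
        rw [neg_neg]; exact hmax hp⟩
  refine ⟨q, hq, η, hη, fun p hp l hl x hx y hy hxy => ?_⟩
  refine (convex_Icc (p.1 - η) (p.1 + η)).image_sub_le_mul_sub_of_deriv_le
    (differentiable_fst hf l).continuous.continuousOn (differentiable_fst hf l).differentiableOn
    (fun z hz => hqle (z, l) ?_) x hx y hy hxy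
  have hz' := interior_subset hz
  refine Metric.mem_cthickening_of_dist_le _ p _ _ hp ?_
  rw [Prod.dist_eq, Real.dist_eq, Real.dist_eq]
  exact max_le (abs_le.2 ⟨by linarith [hz'.1], by linarith [hz'.2]⟩) hl

theorem exists_contractsNear_point (hf : ContDiff ℝ 2 (fun p : ℝ × ℝ => f p.1 p.2)) {Y l₀ : ℝ}
    (hneg : deriv (fun x => f x l₀) Y < 0) : ∃ q > 0, ∃ η > 0, ContractsNear f q η Y l₀ := by
  obtain ⟨q, hq, η, hη, h⟩ := exists_contractsNear hf (isCompact_singleton (x := (Y, l₀)))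
    (by simpa using hneg)
  exact ⟨q, hq, η, hη, h _ rfl⟩

variable {q η Y l₀ : ℝ}

theorem ContractsNear.strictAntiOn (h : ContractsNear f q η Y l₀) (hq : 0 < q) {l : ℝ}
    (hl : |l - l₀| ≤ η) : StrictAntiOn (fun x => f x l) (Icc (Y - η) (Y + η)) :=
  fun x hx y hy hxy => by
    have := h l hl x hx y hy hxy.le
    have h2 := mul_pos hq (sub_pos.2 hxy)
    simp only
    linarith

theorem ContractsNear.eventually_inward (h : ContractsNear f q η Y l₀) (hq : 0 < q) (hη : 0 < η)
    (hf : ContDiff ℝ 2 (fun p : ℝ × ℝ => f p.1 p.2)) (h0 : f Y l₀ = 0) {ε : ℝ} (hε : 0 < ε)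
    (hεη : ε ≤ η) : ∀ᶠ l in 𝓝 l₀, f (Y + ε) l < 0 ∧ 0 < f (Y - ε) l := by
  have hc : ∀ x, Continuous fun l => f x l := fun x =>
    hf.continuous.comp (by fun_prop : Continuous fun l : ℝ => (x, l))
  have hanti := h.strictAntiOn hq (l := l₀) (by simpa using hη.le)
  have hY : Y ∈ Icc (Y - η) (Y + η) := ⟨by linarith, by linarith⟩
  refine ((hc _).continuousAt.eventually_lt continuousAt_const ?_).and
    (continuousAt_const.eventually_lt (hc _).continuousAt ?_)
  · rw [← h0]
    exact hanti hY ⟨by linarith, by linarith⟩ (by linarith)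
  · rw [← h0]
    exact hanti ⟨by linarith, by linarith⟩ hY (by linarith)

end Contraction

/-- A globally defined solution at rate `r` emanating from `X`. -/
structure IsGlobalEmanating (f : ℝ → ℝ → ℝ) (L : ℝ → ℝ) (X r : ℝ) (x : ℝ → ℝ) : Prop where
  isIntegralCurve : IsIntegralCurve x (shiftField f L r)
  tendsto_atBot : Tendsto x atBot (𝓝 X)

/-! ### The parameter-shift equation: the emanating solution and its possible limits -/

namespace StandingAssumptions

variable {f : ℝ → ℝ → ℝ} {lm lp : ℝ} {Xs L : ℝ → ℝ} {r : ℝ}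

theorem lm_lt_lp (h : StandingAssumptions f lm lp Xs L) : lm < lp :=
  ((h.mapsTo_L 0).1.trans_lt (h.strictMono_L zero_lt_one)).trans_le (h.mapsTo_L 1).2

theorem lm_mem (h : StandingAssumptions f lm lp Xs L) : lm ∈ Icc lm lp :=
  left_mem_Icc.2 h.lm_lt_lp.le

theorem lp_mem (h : StandingAssumptions f lm lp Xs L) : lp ∈ Icc lm lp :=
  right_mem_Icc.2 h.lm_lt_lp.le

theorem continuous_f (h : StandingAssumptions f lm lp Xs L) :
    Continuous (fun p : ℝ × ℝ => f p.1 p.2) := h.contDiff_f.continuous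

theorem isTameField (h : StandingAssumptions f lm lp Xs L) (r : ℝ) :
    IsTameField (shiftField f L r) := by
  have hcd : ContDiff ℝ 1 (fun p : ℝ × ℝ => f p.2 (L (r * p.1))) := by
    have h1 : ContDiff ℝ 2 (fun p : ℝ × ℝ => f p.2 (L (r * p.1))) :=
      h.contDiff_f.comp (contDiff_snd.prodMk
        (h.contDiff_L.comp (contDiff_const.mul contDiff_fst)))
    exact h1.of_le one_le_two
  refine ⟨fun x => hcd.continuous.comp (by fun_prop : Continuous fun t : ℝ => (t, x)), ?_,
    fun R => ?_⟩
  · obtain ⟨M, hM⟩ := h.bounded_f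
    exact ⟨M, fun t x => hM x _⟩
  · have hcomp : IsCompact (Icc (-R) R ×ˢ Icc (-R) R) := isCompact_Icc.prod isCompact_Icc
    obtain ⟨K, hK⟩ := LocallyLipschitzOn.exists_lipschitzOnWith_of_compact hcomp
      (hcd.locallyLipschitz.locallyLipschitzOn)
    refine ⟨K, fun t ht => LipschitzOnWith.of_dist_le_mul fun x hx y hy => ?_⟩
    have := hK.dist_le_mul (t, x) ⟨ht, hx⟩ (t, y) ⟨ht, hy⟩
    simpa [Prod.dist_eq, shiftField] using this

theorem tendsto_L_mul_atTop (h : StandingAssumptions f lm lp Xs L) (hr : 0 < r) :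
    Tendsto (fun t => L (r * t)) atTop (𝓝 lp) :=
  h.tendsto_L_atTop.comp (tendsto_id.const_mul_atTop hr)

theorem tendsto_L_mul_atBot (h : StandingAssumptions f lm lp Xs L) (hr : 0 < r) :
    Tendsto (fun t => L (r * t)) atBot (𝓝 lm) :=
  h.tendsto_L_atBot.comp (tendsto_id.const_mul_atBot hr)

theorem exists_strictAntiOn_atBot (h : StandingAssumptions f lm lp Xs L) (hr : 0 < r) :
    ∃ η > 0, ∃ T, (∀ t ≤ T, StrictAntiOn (shiftField f L r t) (Icc (Xs lm - η) (Xs lm + η))) ∧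
      ∀ ε, 0 < ε → ε ≤ η → ∃ T, ∀ t ≤ T, shiftField f L r t (Xs lm + ε) < 0 ∧
        0 < shiftField f L r t (Xs lm - ε) := by
  obtain ⟨q, hq, η, hη, hc⟩ := exists_contractsNear_point h.contDiff_f (h.stable_Xs lm h.lm_mem).2
  have hL := h.tendsto_L_mul_atBot hr
  obtain ⟨T, hT⟩ := eventually_atBot.1 (Metric.tendsto_nhds.1 hL η hη)
  refine ⟨η, hη, T, fun t ht => ?_, fun ε hε hεη => ?_⟩
  · have := hT t ht
    rw [Real.dist_eq] at this
    exact hc.strictAntiOn hq this.le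
  · exact eventually_atBot.1 (hL.eventually
      (hc.eventually_inward hq hη h.contDiff_f (h.stable_Xs lm h.lm_mem).1 hε hεη))

theorem exists_isGlobalEmanating (h : StandingAssumptions f lm lp Xs L) (hr : 0 < r) :
    ∃ x, IsGlobalEmanating f L (Xs lm) r x := by
  obtain ⟨η, hη, T, hanti, hin⟩ := h.exists_strictAntiOn_atBot hr
  obtain ⟨x, hx, hl⟩ := (h.isTameField r).exists_tendsto_atBot hη hanti hin
  exact ⟨x, hx, hl⟩

/-- A global emanating solution exists, and maximality must accommodate it, so the maximal interval
is the whole line. -/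
theorem isPullbackAttractor_iff (h : StandingAssumptions f lm lp Xs L) (hr : 0 < r) {b : EReal}
    {x : ℝ → ℝ} : IsPullbackAttractor (shiftField f L r) (Xs lm) b x ↔
      b = ⊤ ∧ IsGlobalEmanating f L (Xs lm) r x := by
  obtain ⟨η, hη, T, hanti, -⟩ := h.exists_strictAntiOn_atBot hr
  constructor
  · rintro ⟨⟨hb, hx, hl⟩, hmax⟩
    obtain ⟨z, hz⟩ := h.exists_isGlobalEmanating hr
    have hbt : b = ⊤ := top_le_iff.1
      (hmax ⊤ z ⟨bot_lt_top, hz.1.isIntegralCurveOn _, hz.2⟩).1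
    subst hbt
    rw [leftRay_top, isIntegralCurveOn_univ] at hx
    exact ⟨rfl, hx, hl⟩
  · rintro ⟨rfl, hx, hl⟩
    exact (h.isTameField r).isPullbackAttractor hη hanti hx hl

theorem isGlobalEmanating_unique (h : StandingAssumptions f lm lp Xs L) (hr : 0 < r)
    {x y : ℝ → ℝ} (hx : IsGlobalEmanating f L (Xs lm) r x)
    (hy : IsGlobalEmanating f L (Xs lm) r y) : y = x := by
  have := ((h.isPullbackAttractor_iff hr).2 ⟨rfl, hx⟩).2 ⊤ y
    ⟨bot_lt_top, hy.1.isIntegralCurveOn _, hy.2⟩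
  exact funext fun t => this.2 (EReal.coe_lt_top t)

/-- If `f` vanished at `lp` on an open set, its derivative would vanish there too. Hyperbolicity
forbids this, since the exceptional parameters lie in the open interval. -/
theorem dense_ne_zero (h : StandingAssumptions f lm lp Xs L) : Dense {c | f c lp ≠ 0} := by
  obtain ⟨S, -, hS, hyp⟩ := h.hyperbolic
  refine dense_iff_inter_open.2 fun U hU ⟨x, hx⟩ => ?_
  by_contra hne
  have hz : ∀ y ∈ U, f y lp = 0 := fun y hy => by
    by_contra h0
    exact hne ⟨y, hy, h0⟩
  refine hyp lp ⟨h.lp_mem, fun hlp => lt_irrefl _ (hS hlp).2⟩ x (hz x hx) ?_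
  have hev : (fun y => f y lp) =ᶠ[𝓝 x] fun _ => 0 := by
    filter_upwards [hU.mem_nhds hx] with y hy using hz y hy
  rw [hev.deriv_eq]
  simp

theorem deriv_ne_zero (h : StandingAssumptions f lm lp Xs L) {x : ℝ} (hx : f x lp = 0) :
    deriv (fun y => f y lp) x ≠ 0 := by
  obtain ⟨S, -, hS, hyp⟩ := h.hyperbolic
  exact hyp lp ⟨h.lp_mem, fun hlp => lt_irrefl _ (hS hlp).2⟩ x hx

theorem tendsto_cases (h : StandingAssumptions f lm lp Xs L) (hr : 0 < r) {x : ℝ → ℝ}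
    (hx : IsIntegralCurve x (shiftField f L r)) :
    Tendsto x atTop atTop ∨ Tendsto x atTop atBot ∨ ∃ l, f l lp = 0 ∧ Tendsto x atTop (𝓝 l) := by
  have hL := h.tendsto_L_mul_atTop hr
  have hc : ∀ {u : ℝ → ℝ} {c}, Tendsto u atTop (𝓝 c) →
      Tendsto (fun t => shiftField f L r t (u t)) atTop (𝓝 (f c lp)) := fun {u c} hu =>
    (h.continuous_f.tendsto (c, lp)).comp (hu.prodMk_nhds hL)
  rcases tendsto_atTop_or_atBot_or_nhds (a := 0) (hx.isIntegralCurveOn _)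
    (fun c => hc tendsto_const_nhds) h.dense_ne_zero with h1 | h1 | ⟨l, h1⟩
  · exact Or.inl h1
  · exact Or.inr (Or.inl h1)
  · exact Or.inr (Or.inr ⟨l, eq_zero_of_tendsto (a := 0) (hx.isIntegralCurveOn _) h1 (hc h1), h1⟩)

/-- A trapped solution cannot diverge, so it converges to an equilibrium in the window, and strict
monotonicity leaves only `Y`. -/
theorem tendsto_of_eventually_mem (h : StandingAssumptions f lm lp Xs L) (hr : 0 < r)
    {x : ℝ → ℝ} (hx : IsIntegralCurve x (shiftField f L r)) {Y η : ℝ} (hη : 0 < η)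
    (hY : f Y lp = 0)
    (hanti : StrictAntiOn (fun x => f x lp) (Icc (Y - η) (Y + η)))
    (hev : ∀ᶠ t in atTop, x t ∈ Icc (Y - η) (Y + η)) : Tendsto x atTop (𝓝 Y) := by
  rcases h.tendsto_cases hr hx with h1 | h1 | ⟨l, hl, h1⟩
  · obtain ⟨t, ht, ht'⟩ := (hev.and (h1.eventually_gt_atTop (Y + η))).exists
    exact absurd ht.2 (not_le.2 ht')
  · obtain ⟨t, ht, ht'⟩ := (hev.and (h1.eventually_lt_atBot (Y - η))).exists
    exact absurd ht.1 (not_le.2 ht')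
  · have hmem := isClosed_Icc.mem_of_tendsto h1 hev
    have : l = Y := hanti.injOn hmem ⟨by linarith, by linarith⟩ (hl.trans hY.symm)
    rwa [← this]

end StandingAssumptions
-- Slow shifts, and continuous dependence on the rate
namespace StandingAssumptions

variable {f : ℝ → ℝ → ℝ} {lm lp : ℝ} {Xs L : ℝ → ℝ} {r r₀ : ℝ} {x₀ : ℝ → ℝ}

theorem exists_abs_deriv_L_le (h : StandingAssumptions f lm lp Xs L) :
    ∃ C, 0 ≤ C ∧ ∀ t, |deriv L t| ≤ C := by
  obtain ⟨A, hA⟩ := eventually_atBot.1 (Metric.tendsto_nhds.1 h.tendsto_deriv_L_atBot 1 one_pos)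
  obtain ⟨B, hB⟩ := eventually_atTop.1 (Metric.tendsto_nhds.1 h.tendsto_deriv_L_atTop 1 one_pos)
  obtain ⟨C, hC⟩ := isCompact_Icc.exists_bound_of_continuousOn
    ((h.contDiff_L.continuous_deriv one_le_two).continuousOn (s := Icc A B))
  refine ⟨max 1 C, zero_le_one.trans (le_max_left _ _), fun t => ?_⟩
  simp only [Real.dist_eq, sub_zero] at hA hB
  rcases le_total t A with h1 | h1
  · exact (hA t h1).le.trans (le_max_left _ _)
  rcases le_total B t with h2 | h2
  · exact (hB t h2).le.trans (le_max_left _ _)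
  · exact (hC t ⟨h1, h2⟩).trans (le_max_right _ _)

theorem exists_bound_pos (h : StandingAssumptions f lm lp Xs L) :
    ∃ M > 0, ∀ x l, |f x l| ≤ M := by
  obtain ⟨M, hM⟩ := h.bounded_f
  exact ⟨max M 1, lt_max_of_lt_right one_pos, fun x l => (hM x l).trans (le_max_left _ _)⟩

theorem tendsto_Xs_atBot (h : StandingAssumptions f lm lp Xs L) (hr : 0 < r) :
    Tendsto (fun t => Xs (L (r * t))) atBot (𝓝 (Xs lm)) :=
  (h.continuousOn_Xs lm h.lm_mem).tendsto.comp (tendsto_nhdsWithin_iff.2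
    ⟨h.tendsto_L_mul_atBot hr, Eventually.of_forall fun _ => h.mapsTo_L _⟩)

theorem tendsto_Xs_atTop (h : StandingAssumptions f lm lp Xs L) (hr : 0 < r) :
    Tendsto (fun t => Xs (L (r * t))) atTop (𝓝 (Xs lp)) :=
  (h.continuousOn_Xs lp h.lp_mem).tendsto.comp (tendsto_nhdsWithin_iff.2
    ⟨h.tendsto_L_mul_atTop hr, Eventually.of_forall fun _ => h.mapsTo_L _⟩)

/-- For slow parameter shifts the pullback attracting solution end-point tracks `Xs`. -/
theorem exists_forall_lt_tendsto (h : StandingAssumptions f lm lp Xs L) :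
    ∃ r₁ > 0, ∀ r, 0 < r → r < r₁ → ∀ x, IsGlobalEmanating f L (Xs lm) r x →
      Tendsto x atTop (𝓝 (Xs lp)) := by
  have hcomp : IsCompact ((fun l => (Xs l, l)) '' Icc lm lp) :=
    isCompact_Icc.image_of_continuousOn (h.continuousOn_Xs.prodMk continuousOn_id)
  obtain ⟨q, hq, η, hη, hcon⟩ := exists_contractsNear h.contDiff_f hcomp (by
    rintro _ ⟨l, hl, rfl⟩
    exact (h.stable_Xs l hl).2)
  replace hcon : ∀ l ∈ Icc lm lp, ContractsNear f q η (Xs l) l := fun l hl =>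
    hcon _ (mem_image_of_mem _ hl)
  -- `Xs` is only assumed continuous. A polynomial approximation gives a tube centre `P (L (r t))`
  -- that can be differentiated.
  obtain ⟨P, hP⟩ := exists_polynomial_near_of_continuousOn lm lp Xs h.continuousOn_Xs (η / 4)
    (by positivity)
  obtain ⟨C, hC0, hC⟩ := h.exists_abs_deriv_L_le
  obtain ⟨D, hD⟩ := isCompact_Icc.exists_bound_of_continuousOn
    (P.derivative.continuous.continuousOn (s := Icc lm lp))
  have hD0 : 0 ≤ D := (norm_nonneg _).trans (hD lm h.lm_mem)
  -- The edges at distance `η / 2` from the centre are at least `η / 4` from `Xs`, so the inward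
  -- speed there is at least `q * (η / 4)`. The centre moves at speed at most `D * C * r`; the `+ 1`
  -- guards against a zero denominator.
  refine ⟨q * (η / 4) / (D * C + 1), by positivity, fun r hr hrlt x hx => ?_⟩
  rw [lt_div_iff₀ (by positivity)] at hrlt
  have hB : ∀ t, HasDerivAt (fun t => P.eval (L (r * t)))
      (P.derivative.eval (L (r * t)) * (deriv L (r * t) * (r * 1))) t := fun t =>
    HasDerivAt.comp (h₂ := fun y => P.eval y) (h := fun t => L (r * t)) t
      (P.hasDerivAt (L (r * t)))
      ((h.contDiff_L.differentiable two_ne_zero (r * t)).hasDerivAt.comp t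
        ((hasDerivAt_id t).const_mul r))
  have hB' : ∀ t, |P.derivative.eval (L (r * t)) * (deriv L (r * t) * (r * 1))| <
      q * (η / 4) := fun t => by
    have h1 := hD _ (h.mapsTo_L (r * t))
    have h2 := hC (r * t)
    rw [Real.norm_eq_abs] at h1
    rw [mul_one, ← mul_assoc, abs_mul, abs_mul, abs_of_pos hr]
    have h3 := mul_le_mul h1 h2 (abs_nonneg _) hD0
    nlinarith
  have htube : ∀ t, |x t - P.eval (L (r * t))| ≤ η / 2 := by
    intro t
    have hstart : ∀ᶠ s in atBot, |x s - Xs (L (r * s))| < η / 4 := by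
      have := Metric.tendsto_nhds.1 (hx.2.sub (h.tendsto_Xs_atBot hr)) (η / 4) (by positivity)
      simpa [Real.dist_eq] using this
    obtain ⟨s, hs, hst⟩ := (hstart.and (eventually_le_atBot t)).exists
    have hPs := abs_lt.1 (hP _ (h.mapsTo_L (r * s)))
    rw [abs_lt] at hs
    have hval : ∀ u, f (P.eval (L (r * u)) + η / 2) (L (r * u)) ≤ -(q * (η / 4)) ∧
        q * (η / 4) ≤ f (P.eval (L (r * u)) - η / 2) (L (r * u)) := by
      intro u
      have hl := h.mapsTo_L (r * u)
      have hPu := abs_lt.1 (hP _ hl)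
      have h0 : f (Xs (L (r * u))) (L (r * u)) = 0 := (h.stable_Xs _ hl).1
      have hc := hcon _ hl (L (r * u)) (by simpa using hη.le)
      have h1 := hc (Xs (L (r * u))) ⟨by linarith, by linarith⟩
        (P.eval (L (r * u)) + η / 2) ⟨by linarith, by linarith⟩ (by linarith)
      have h2 := hc (P.eval (L (r * u)) - η / 2) ⟨by linarith, by linarith⟩
        (Xs (L (r * u))) ⟨by linarith, by linarith⟩ (by linarith)
      constructor <;> nlinarith
    have hu := le_of_deriv_lt_of_eq (hx.1.isIntegralCurveOn (Icc s t))
      (fun u _ => ((hB u).add_const (η / 2)).hasDerivWithinAt) (by linarith)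
      (fun u _ he => by
        rw [he]
        exact (hval u).1.trans_lt (abs_lt.1 (hB' u)).1) t ⟨hst, le_rfl⟩
    have hl := le_of_deriv_lt_of_eq
      (fun u _ => ((hB u).sub_const (η / 2)).hasDerivWithinAt)
      (hx.1.isIntegralCurveOn (Icc s t)) (by linarith)
      (fun u _ he => by
        rw [← he]
        exact (abs_lt.1 (hB' u)).2.trans_le (hval u).2) t ⟨hst, le_rfl⟩
    exact abs_le.2 ⟨by linarith, by linarith⟩
  refine h.tendsto_of_eventually_mem hr hx.1 hη (h.stable_Xs lp h.lp_mem).1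
    ((hcon lp h.lp_mem).strictAntiOn hq (by simpa using hη.le)) ?_
  filter_upwards [Metric.tendsto_nhds.1 (h.tendsto_Xs_atTop hr) (η / 4) (by positivity)] with t ht
  have h1 := abs_le.1 (htube t)
  have h2 := abs_lt.1 (hP _ (h.mapsTo_L (r * t)))
  rw [Real.dist_eq, abs_lt] at ht
  exact ⟨by linarith, by linarith⟩

/-- Run in time `r / r₀ * t`, the reference solution sees the same parameter `L (r * t)`. The change
of rate survives only as a factor `r / r₀`, a uniformly small defect because `f` is bounded. -/
theorem hasDerivAt_rescaled (hr₀ : 0 < r₀) (hx₀ : IsIntegralCurve x₀ (shiftField f L r₀))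
    (r t : ℝ) : HasDerivAt (fun t => x₀ (r / r₀ * t))
      (r / r₀ * f (x₀ (r / r₀ * t)) (L (r * t))) t := by
  have h1 := (hx₀ (r / r₀ * t)).comp t ((hasDerivAt_id t).const_mul (r / r₀))
  have h2 : r₀ * (r / r₀ * t) = r * t := by field_simp
  simp only [shiftField, h2] at h1
  convert! h1 using 1
  ring

theorem eventually_rate_error_lt (hr₀ : 0 < r₀) (M : ℝ) {c : ℝ} (hc : 0 < c) :
    ∀ᶠ r in 𝓝 r₀, |r / r₀ - 1| * M < c := by
  have hcont : Continuous fun r : ℝ => |r / r₀ - 1| * M := by fun_prop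
  refine hcont.continuousAt.eventually_lt continuousAt_const ?_
  rwa [div_self hr₀.ne', sub_self, abs_zero, zero_mul]

theorem abs_rescaled_sub_le {M : ℝ} (hM : ∀ x l, |f x l| ≤ M) (r r₀ z l : ℝ) :
    |r / r₀ * f z l - f z l| ≤ |r / r₀ - 1| * M := by
  have : r / r₀ * f z l - f z l = (r / r₀ - 1) * f z l := by ring
  rw [this, abs_mul]
  exact mul_le_mul_of_nonneg_left (hM _ _) (abs_nonneg _)

/-- Continuity in the rate of the emanating solution, uniformly in the far past. -/
theorem exists_eventually_close_atBot (h : StandingAssumptions f lm lp Xs L) (hr₀ : 0 < r₀)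
    (hx₀ : IsGlobalEmanating f L (Xs lm) r₀ x₀) :
    ∃ T₁, ∀ ε > 0, ∀ᶠ r in 𝓝 r₀, ∀ x, IsGlobalEmanating f L (Xs lm) r x →
      ∀ t, r * t ≤ T₁ → |x t - x₀ (r / r₀ * t)| ≤ ε := by
  obtain ⟨q, hq, η, hη, hc⟩ := exists_contractsNear_point h.contDiff_f (h.stable_Xs lm h.lm_mem).2
  obtain ⟨T, hT⟩ := eventually_atBot.1 (Metric.tendsto_nhds.1 h.tendsto_L_atBot η hη)
  obtain ⟨S, hS⟩ := eventually_atBot.1 (Metric.tendsto_nhds.1 hx₀.2 (η / 2) (by positivity))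
  obtain ⟨M, hM0, hM⟩ := h.exists_bound_pos
  refine ⟨min T (r₀ * S), fun ε hε => ?_⟩
  -- Radius at most `η / 2` keeps the tube in the contraction window, where the contraction `q * e`
  -- beats the rate defect.
  set e := min ε (η / 2)
  have he : 0 < e := lt_min hε (by positivity)
  have heη : e ≤ η / 2 := min_le_right _ _
  filter_upwards [eventually_gt_nhds hr₀, eventually_rate_error_lt hr₀ M (mul_pos hq he)]
    with r hr hm x hx t ht
  have hscale : Tendsto (fun t => r / r₀ * t) atBot atBot :=
    tendsto_id.const_mul_atBot (by positivity)
  have hstart : ∀ᶠ s in atBot, |x s - x₀ (r / r₀ * s)| < e := by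
    have := Metric.tendsto_nhds.1 (hx.2.sub (hx₀.2.comp hscale)) e he
    simpa [Real.dist_eq] using this
  obtain ⟨s, hs, hst⟩ := (hstart.and (eventually_le_atBot t)).exists
  have hpast : ∀ u ∈ Icc s t, |L (r * u) - lm| ≤ η ∧ |x₀ (r / r₀ * u) - Xs lm| < η / 2 := by
    intro u hu
    have h1 : r * u ≤ min T (r₀ * S) := (mul_le_mul_of_nonneg_left hu.2 hr.le).trans ht
    refine ⟨(hT _ (h1.trans (min_le_left _ _))).le, hS _ ?_⟩
    rw [div_mul_eq_mul_div, div_le_iff₀ hr₀, mul_comm S]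
    exact h1.trans (min_le_right _ _)
  refine (abs_sub_le_of_approx (E := fun _ => e) (E' := fun _ => 0)
    (hx.1.isIntegralCurveOn (Icc s t)) (fun u _ => hasDerivAt_rescaled hr₀ hx₀.1 r u)
    (fun u _ => hasDerivAt_const u e) (fun u _ => abs_rescaled_sub_le hM r r₀ _ _)
    (fun u hu => ?_) (fun u hu => ?_) hs.le t ⟨hst, le_rfl⟩).trans (min_le_left _ _)
  · obtain ⟨h1, h2⟩ := hpast u hu
    rw [abs_lt] at h2
    have := hc _ h1 (x₀ (r / r₀ * u)) ⟨by linarith, by linarith⟩ (x₀ (r / r₀ * u) + e)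
      ⟨by linarith, by linarith⟩ (by linarith)
    simp only [shiftField]
    linarith
  · obtain ⟨h1, h2⟩ := hpast u hu
    rw [abs_lt] at h2
    have := hc _ h1 (x₀ (r / r₀ * u) - e) ⟨by linarith, by linarith⟩ (x₀ (r / r₀ * u))
      ⟨by linarith, by linarith⟩ (by linarith)
    simp only [shiftField]
    linarith

/-- Continuity in the rate of the emanating solution on half-lines of rescaled time. -/
theorem eventually_close (h : StandingAssumptions f lm lp Xs L) (hr₀ : 0 < r₀)
    (hx₀ : IsGlobalEmanating f L (Xs lm) r₀ x₀) (T : ℝ) {ε : ℝ} (hε : 0 < ε) :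
    ∀ᶠ r in 𝓝 r₀, ∀ x, IsGlobalEmanating f L (Xs lm) r x →
      ∀ t, r * t ≤ T → |x t - x₀ (r / r₀ * t)| ≤ ε := by
  obtain ⟨T₁, hT₁⟩ := h.exists_eventually_close_atBot hr₀ hx₀
  obtain ⟨M, hM0, hM⟩ := h.exists_bound_pos
  obtain ⟨C, hC⟩ := isCompact_Icc.exists_bound_of_continuousOn
    (hx₀.1.continuous.continuousOn (s := Icc (T₁ / r₀) (T / r₀)))
  set R := max (C + ε) (max |T₁| |T|)
  have hR1 : C + ε ≤ R := le_max_left _ _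
  have hR2 : |T₁| ≤ R := (le_max_left _ _).trans (le_max_right _ _)
  have hR3 : |T| ≤ R := (le_max_right _ _).trans (le_max_right _ _)
  -- Rate `1` suffices, since the field is evaluated at the rescaled time `r * u`.
  obtain ⟨K, hK⟩ := (h.isTameField 1).lipschitz R
  -- This gives `k * r ≥ K + 1` once `r > r₀ / 2`: `K` absorbs the Lipschitz growth and the extra
  -- `1` absorbs the defect.
  set k : ℝ := 2 * (K + 1) / r₀ with hk
  have hk0 : 0 < k := by positivity
  -- The tube has radius `e` at rescaled time `T₁` and reaches `ε` exactly at `T`.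
  set e := ε * Real.exp (-(k * (T - T₁))) with he
  have he0 : 0 < e := by positivity
  filter_upwards [eventually_gt_nhds (half_lt_self hr₀), hT₁ ε hε, hT₁ e he0,
    eventually_rate_error_lt hr₀ M he0] with r hr2 hcε hce hm x hx t ht
  have hr : 0 < r := (half_pos hr₀).trans hr2
  rcases le_total (r * t) T₁ with hle | hle
  · exact hcε x hx t hle
  have hkr : K + 1 ≤ k * r := by
    rw [hk, div_mul_eq_mul_div, le_div_iff₀ hr₀]
    nlinarith [K.coe_nonneg]
  have hE : ∀ u, HasDerivAt (fun u => e * Real.exp (k * (r * u - T₁)))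
      (e * (Real.exp (k * (r * u - T₁)) * (k * (r * 1)))) u := fun u =>
    ((((hasDerivAt_id u).const_mul r).sub_const T₁).const_mul k).exp.const_mul e
  have hEle : ∀ u, r * u ≤ T → e * Real.exp (k * (r * u - T₁)) ≤ ε := fun u hu => by
    rw [he, mul_assoc, ← Real.exp_add]
    refine mul_le_of_le_one_right hε.le (Real.exp_le_one_iff.2 ?_)
    nlinarith
  have hstep : ∀ u ∈ Icc (T₁ / r) t, ∀ z, |z - x₀ (r / r₀ * u)| ≤
      e * Real.exp (k * (r * u - T₁)) →
      |f z (L (r * u)) - f (x₀ (r / r₀ * u)) (L (r * u))| <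
        e * (Real.exp (k * (r * u - T₁)) * (k * (r * 1))) - |r / r₀ - 1| * M := by
    intro u hu z hz
    have hu1 : T₁ ≤ r * u := by rw [mul_comm]; exact (div_le_iff₀ hr).1 hu.1
    have hu2 : r * u ≤ T := (mul_le_mul_of_nonneg_left hu.2 hr.le).trans ht
    have hx₀u : |x₀ (r / r₀ * u)| ≤ C := by
      refine hC _ ⟨?_, ?_⟩
      · rw [div_mul_eq_mul_div]; gcongr
      · rw [div_mul_eq_mul_div]; gcongr
    have hEu := hEle u hu2
    have hE1 : e ≤ e * Real.exp (k * (r * u - T₁)) :=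
      le_mul_of_one_le_right he0.le (Real.one_le_exp (mul_nonneg hk0.le (sub_nonneg.2 hu1)))
    have hlip := (hK (r * u) ⟨by linarith [(abs_le.1 hR2).1], by linarith [(abs_le.1 hR3).2]⟩)
    rw [abs_le] at hx₀u
    have hz' := abs_le.1 hz
    have h1 := hlip.dist_le_mul z ⟨by linarith, by linarith⟩ (x₀ (r / r₀ * u))
      ⟨by linarith, by linarith⟩
    simp only [shiftField, one_mul, Real.dist_eq] at h1
    have h2 := mul_le_mul_of_nonneg_left hz K.coe_nonneg
    have h3 := mul_le_mul_of_nonneg_left hkr (he0.le.trans hE1)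
    linarith
  have ht' : T₁ / r ≤ t := (div_le_iff₀ hr).2 (by rwa [mul_comm])
  refine (abs_sub_le_of_approx (E := fun u => e * Real.exp (k * (r * u - T₁)))
    (hx.1.isIntegralCurveOn (Icc (T₁ / r) t)) (fun u _ => hasDerivAt_rescaled hr₀ hx₀.1 r u)
    (fun u _ => hE u) (fun u _ => abs_rescaled_sub_le hM r r₀ _ _)
    (fun u hu => ?_) (fun u hu => ?_) ?_ t ⟨ht', le_rfl⟩).trans (hEle t ht)
  · exact (le_abs_self _).trans_lt (hstep u hu _ (by
      rw [add_sub_cancel_left, abs_of_pos (by positivity)]))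
  · refine (le_abs_self _).trans_lt ?_
    rw [abs_sub_comm]
    exact hstep u hu _ (by
      rw [sub_sub_cancel_left, abs_neg, abs_of_pos (by positivity)])
  · have h1 : r * (T₁ / r) = T₁ := by field_simp
    simpa [h1] using hce x hx (T₁ / r) h1.le

theorem eventually_abs_sub_le (h : StandingAssumptions f lm lp Xs L) (hr₀ : 0 < r₀)
    (hx₀ : IsGlobalEmanating f L (Xs lm) r₀ x₀) (T : ℝ) {ε : ℝ} (hε : 0 < ε) :
    ∀ᶠ r in 𝓝 r₀, ∀ x, IsGlobalEmanating f L (Xs lm) r x → |x (T / r) - x₀ (T / r₀)| ≤ ε := by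
  filter_upwards [eventually_gt_nhds hr₀, h.eventually_close hr₀ hx₀ T hε] with r hr hc x hx
  have h1 : r * (T / r) = T := by field_simp
  have h2 : r / r₀ * (T / r) = T / r₀ := by field_simp
  simpa [h2] using hc x hx (T / r) h1.le

/-- After rescaled time `T` the window around `Y` is inward forever. Nearby solutions are inside it
at that moment, hence trapped. -/
theorem eventually_tendsto_of_stable (h : StandingAssumptions f lm lp Xs L) (hr₀ : 0 < r₀)
    (hx₀ : IsGlobalEmanating f L (Xs lm) r₀ x₀) {Y : ℝ} (hlim : Tendsto x₀ atTop (𝓝 Y))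
    (hY : IsStableHyperbolic f lp Y) :
    ∀ᶠ r in 𝓝 r₀, ∀ x, IsGlobalEmanating f L (Xs lm) r x → Tendsto x atTop (𝓝 Y) := by
  obtain ⟨q, hq, η, hη, hc⟩ := exists_contractsNear_point h.contDiff_f hY.2
  obtain ⟨T, hT⟩ := eventually_atTop.1 ((h.tendsto_L_atTop.eventually
    (hc.eventually_inward hq hη h.contDiff_f hY.1 hη le_rfl)).and
    (Metric.tendsto_nhds.1 (hlim.comp (tendsto_id.atTop_div_const hr₀)) (η / 2) (by positivity)))
  filter_upwards [eventually_gt_nhds hr₀,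
    h.eventually_abs_sub_le hr₀ hx₀ T (show 0 < η / 2 by positivity)] with r hr hclose x hx
  refine h.tendsto_of_eventually_mem hr hx.1 hη hY.1
    (hc.strictAntiOn hq (by simpa using hη.le)) (eventually_atTop.2 ⟨T / r, fun t ht => ?_⟩)
  refine mem_Icc_of_inward (hx.1.isIntegralCurveOn (Icc (T / r) t)) ?_ (fun s hs => ?_) t
    ⟨ht, le_rfl⟩
  · have h1 := abs_le.1 (hclose x hx)
    have h2 := (hT T le_rfl).2
    simp only [Function.comp_apply, id, Real.dist_eq, abs_lt] at h2
    exact ⟨by linarith, by linarith⟩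
  · exact (hT (r * s) (by rw [mul_comm]; exact (div_le_iff₀ hr).1 hs.1)).1

theorem forall_neg_or_forall_pos (h : StandingAssumptions f lm lp Xs L) {K a b : ℝ}
    (hK : ∀ l ∈ Icc a b, ¬ IsEquilibrium f l K) :
    (∀ l ∈ Icc a b, f K l < 0) ∨ ∀ l ∈ Icc a b, 0 < f K l := by
  by_contra! hne
  obtain ⟨⟨c, hc, hc0⟩, d, hd, hd0⟩ := hne
  have hcont : Continuous fun l => f K l :=
    h.continuous_f.comp (by fun_prop : Continuous fun l : ℝ => (K, l))
  obtain ⟨l, hl, hl0⟩ := isPreconnected_Icc.intermediate_value hd hc hcont.continuousOn ⟨hd0, hc0⟩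
  exact hK l hl hl0

/-- Take a level `K` above both `Y` and an early value of `x₀`, free of equilibria for late
parameters. A negative field on it would have stopped `x₀`, so the field is positive, and nearby
solutions, once above `K`, cannot come back down to `Y`. -/
theorem eventually_not_tendsto_of_atTop (h : StandingAssumptions f lm lp Xs L)
    (hinf : NoEquilibriumFromInfinity f lm lp) (hr₀ : 0 < r₀)
    (hx₀ : IsGlobalEmanating f L (Xs lm) r₀ x₀) (hlim : Tendsto x₀ atTop atTop) (Y : ℝ) :
    ∀ᶠ r in 𝓝 r₀, ∀ x, IsGlobalEmanating f L (Xs lm) r x → ¬ Tendsto x atTop (𝓝 Y) := by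
  obtain ⟨l₀, hl₀, hup, -⟩ := hinf
  obtain ⟨T₁, hT₁⟩ := eventually_atTop.1 (h.tendsto_L_atTop.eventually_const_lt hl₀.2)
  have hmem : ∀ τ ≥ T₁, L τ ∈ Icc l₀ lp := fun τ hτ => ⟨(hT₁ τ hτ).le, (h.mapsTo_L τ).2⟩
  have hmem' : ∀ {r T s : ℝ}, 0 < r → T₁ ≤ T → T / r ≤ s → L (r * s) ∈ Icc l₀ lp :=
    fun hr hT hs => hmem _ (hT.trans (by rw [mul_comm]; exact (div_le_iff₀ hr).1 hs))
  obtain ⟨K, hKR, hK⟩ := hup (max (x₀ (T₁ / r₀)) (Y + 1))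
  rcases h.forall_neg_or_forall_pos hK with hneg | hpos
  · obtain ⟨t, ht, htK⟩ := ((eventually_ge_atTop (T₁ / r₀)).and
      (hlim.eventually_gt_atTop K)).exists
    exact absurd (le_const_of_neg (hx₀.1.isIntegralCurveOn (Icc (T₁ / r₀) t))
      ((le_max_left _ _).trans hKR) (fun s hs => hneg _ (hmem' hr₀ le_rfl hs.1)) t ⟨ht, le_rfl⟩)
      (not_le.2 htK)
  · obtain ⟨T₂, hT₂, hT₂K⟩ := ((eventually_ge_atTop T₁).and
      ((hlim.comp (tendsto_id.atTop_div_const hr₀)).eventually_ge_atTop (K + 1))).exists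
    filter_upwards [eventually_gt_nhds hr₀, h.eventually_abs_sub_le hr₀ hx₀ T₂ one_pos]
      with r hr hclose x hx hY
    have h1 := abs_le.1 (hclose x hx)
    simp only [Function.comp_apply, id] at hT₂K
    have h2 := ge_of_tendsto hY (eventually_atTop.2 ⟨T₂ / r, fun t ht =>
      const_le_of_pos (c := K) (hx.1.isIntegralCurveOn (Icc (T₂ / r) t)) (by linarith)
        (fun s hs => hpos _ (hmem' hr hT₂ hs.1)) t ⟨ht, le_rfl⟩⟩)
    linarith [(le_max_right _ _).trans hKR]

theorem eventually_not_tendsto_of_atBot (h : StandingAssumptions f lm lp Xs L)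
    (hinf : NoEquilibriumFromInfinity f lm lp) (hr₀ : 0 < r₀)
    (hx₀ : IsGlobalEmanating f L (Xs lm) r₀ x₀) (hlim : Tendsto x₀ atTop atBot) (Y : ℝ) :
    ∀ᶠ r in 𝓝 r₀, ∀ x, IsGlobalEmanating f L (Xs lm) r x → ¬ Tendsto x atTop (𝓝 Y) := by
  obtain ⟨l₀, hl₀, -, hdown⟩ := hinf
  obtain ⟨T₁, hT₁⟩ := eventually_atTop.1 (h.tendsto_L_atTop.eventually_const_lt hl₀.2)
  have hmem : ∀ τ ≥ T₁, L τ ∈ Icc l₀ lp := fun τ hτ => ⟨(hT₁ τ hτ).le, (h.mapsTo_L τ).2⟩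
  have hmem' : ∀ {r T s : ℝ}, 0 < r → T₁ ≤ T → T / r ≤ s → L (r * s) ∈ Icc l₀ lp :=
    fun hr hT hs => hmem _ (hT.trans (by rw [mul_comm]; exact (div_le_iff₀ hr).1 hs))
  obtain ⟨K, hKR, hK⟩ := hdown (min (x₀ (T₁ / r₀)) (Y - 1))
  rcases h.forall_neg_or_forall_pos hK with hneg | hpos
  · obtain ⟨T₂, hT₂, hT₂K⟩ := ((eventually_ge_atTop T₁).and
      ((hlim.comp (tendsto_id.atTop_div_const hr₀)).eventually_le_atBot (K - 1))).exists
    filter_upwards [eventually_gt_nhds hr₀, h.eventually_abs_sub_le hr₀ hx₀ T₂ one_pos]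
      with r hr hclose x hx hY
    have h1 := abs_le.1 (hclose x hx)
    simp only [Function.comp_apply, id] at hT₂K
    have h2 := le_of_tendsto hY (eventually_atTop.2 ⟨T₂ / r, fun t ht =>
      le_const_of_neg (c := K) (hx.1.isIntegralCurveOn (Icc (T₂ / r) t)) (by linarith)
        (fun s hs => hneg _ (hmem' hr hT₂ hs.1)) t ⟨ht, le_rfl⟩⟩)
    linarith [hKR.trans (min_le_right _ _)]
  · obtain ⟨t, ht, htK⟩ := ((eventually_ge_atTop (T₁ / r₀)).and
      (hlim.eventually_lt_atBot K)).exists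
    exact absurd (const_le_of_pos (hx₀.1.isIntegralCurveOn (Icc (T₁ / r₀) t))
      (hKR.trans (min_le_left _ _)) (fun s hs => hpos _ (hmem' hr₀ le_rfl hs.1)) t ⟨ht, le_rfl⟩)
      (not_le.2 htK)

/-- Convergence to a stable hyperbolic equilibrium of the future limit problem implies uniform
asymptotic stability. -/
theorem exists_isUniformlyAsymptoticallyStable (h : StandingAssumptions f lm lp Xs L)
    (hr : 0 < r) {x : ℝ → ℝ} (hx : IsIntegralCurve x (shiftField f L r)) {Y : ℝ}
    (hlim : Tendsto x atTop (𝓝 Y)) (hY : IsStableHyperbolic f lp Y) :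
    ∃ t₀, IsUniformlyAsymptoticallyStable (shiftField f L r) t₀ x := by
  obtain ⟨q, hq, η, hη, hc⟩ := exists_contractsNear_point h.contDiff_f hY.2
  obtain ⟨T, hT⟩ := eventually_atTop.1 ((Metric.tendsto_nhds.1 (h.tendsto_L_mul_atTop hr) η hη).and
    (Metric.tendsto_nhds.1 hlim (η / 2) (by positivity)))
  simp only [Real.dist_eq] at hT
  -- Decay at rate `q / 2` instead of `q` provides the strict inequality that the fencing lemma
  -- needs.
  have key : ∀ D, 0 < D → D ≤ η / 2 → ∀ s > T, ∀ z, |x s - z| < D →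
      ∃ y, IsForwardSolution (shiftField f L r) s z y ∧
        ∀ t > s, |x t - y t| ≤ D * Real.exp (-(q / 2) * (t - s)) := by
    intro D hD hDη s hs z hz
    obtain ⟨y, hy0, hy⟩ := (h.isTameField r).exists_isIntegralCurve s z
    refine ⟨y, ⟨hy0, hy.isIntegralCurveOn _⟩, fun t ht => ?_⟩
    have hE : ∀ u, HasDerivAt (fun u => D * Real.exp (-(q / 2) * (u - s)))
        (D * (Real.exp (-(q / 2) * (u - s)) * (-(q / 2) * 1))) u := fun u =>
      (((hasDerivAt_id u).sub_const s).const_mul (-(q / 2))).exp.const_mul D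
    have hEη : ∀ u ∈ Icc s t, 0 < D * Real.exp (-(q / 2) * (u - s)) ∧
        D * Real.exp (-(q / 2) * (u - s)) ≤ η / 2 := fun u hu =>
      ⟨by positivity, (mul_le_of_le_one_right hD.le (Real.exp_le_one_iff.2
        (by nlinarith [hu.1]))).trans hDη⟩
    rw [abs_sub_comm]
    refine abs_sub_le_of_approx (E := fun u => D * Real.exp (-(q / 2) * (u - s))) (m := 0)
      (hy.isIntegralCurveOn (Icc s t)) (fun u _ => hx u) (fun u _ => hE u) (fun u _ => by simp)
      (fun u hu => ?_) (fun u hu => ?_) ?_ t ⟨ht.le, le_rfl⟩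
    · obtain ⟨h1, h2⟩ := hT u (hs.le.trans hu.1)
      obtain ⟨h3, h4⟩ := hEη u hu
      rw [abs_lt] at h2
      have := hc _ h1.le (x u) ⟨by linarith, by linarith⟩
        (x u + D * Real.exp (-(q / 2) * (u - s))) ⟨by linarith, by linarith⟩ (by linarith)
      simp only [shiftField]
      nlinarith [mul_pos hq h3]
    · obtain ⟨h1, h2⟩ := hT u (hs.le.trans hu.1)
      obtain ⟨h3, h4⟩ := hEη u hu
      rw [abs_lt] at h2
      have := hc _ h1.le (x u - D * Real.exp (-(q / 2) * (u - s))) ⟨by linarith, by linarith⟩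
        (x u) ⟨by linarith, by linarith⟩ (by linarith)
      simp only [shiftField]
      nlinarith [mul_pos hq h3]
    · simp only [sub_self, mul_zero, Real.exp_zero, mul_one]
      rw [hy0, abs_sub_comm]
      exact hz.le
  refine ⟨T, fun ε hε => ?_, η / 2, by positivity, fun ε hε => ?_⟩
  · have hpos : 0 < min (ε / 2) (η / 2) := lt_min (by positivity) (by positivity)
    refine ⟨_, hpos, fun s hs z hz => ?_⟩
    obtain ⟨y, hy, hxy⟩ := key _ hpos (min_le_right _ _) s hs z hz
    refine ⟨y, hy, fun t ht => (hxy t ht).trans_lt ?_⟩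
    refine (mul_le_of_le_one_right hpos.le (Real.exp_le_one_iff.2 (by nlinarith))).trans_lt ?_
    exact (min_le_left _ _).trans_lt (half_lt_self hε)
  · have hdecay : Tendsto (fun t => η / 2 * Real.exp (-(q / 2) * t)) atTop (𝓝 0) := by
      have h1 : Tendsto (fun t : ℝ => -(q / 2) * t) atTop atBot :=
        tendsto_id.const_mul_atTop_of_neg (by linarith)
      simpa using (Real.tendsto_exp_atBot.comp h1).const_mul (η / 2)
    obtain ⟨τ, hτ, hτ0⟩ := ((hdecay.eventually_lt_const hε).and (eventually_gt_atTop 0)).exists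
    refine ⟨τ, hτ0, fun s hs z hz => ?_⟩
    obtain ⟨y, hy, hxy⟩ := key _ (by positivity) le_rfl s hs z hz
    refine ⟨y, hy, fun t ht => (hxy t (by linarith)).trans_lt (lt_of_le_of_lt ?_ hτ)⟩
    gcongr 1
    exact Real.exp_le_exp.2 (by nlinarith)

/-- An unstable equilibrium of `f` is a stable one of `-f`, so the contraction estimate applies with
reversed sign. -/
theorem exists_strictMonoOn_atTop (h : StandingAssumptions f lm lp Xs L) (hr : 0 < r) {Xu : ℝ}
    (hXu : IsUnstableHyperbolic f lp Xu) : ∃ η > 0, ∃ T, ∀ t ≥ T,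
      StrictMonoOn (shiftField f L r t) (Icc (Xu - η) (Xu + η)) := by
  have hneg : deriv (fun x => -f x lp) Xu < 0 := by
    have : deriv (fun x => -f x lp) Xu = -deriv (fun x => f x lp) Xu := deriv.fun_neg
    rw [this]
    exact neg_lt_zero.2 hXu.2
  obtain ⟨q, hq, η, hη, hc⟩ := exists_contractsNear_point (f := fun x l => -f x l)
    h.contDiff_f.neg hneg
  obtain ⟨T, hT⟩ := eventually_atTop.1 (Metric.tendsto_nhds.1 (h.tendsto_L_mul_atTop hr) η hη)
  exact ⟨η, hη, T, fun t ht x hx y hy hxy =>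
    neg_lt_neg_iff.1 (hc.strictAntiOn hq (hT t ht).le hx hy hxy)⟩

end StandingAssumptions
-- The critical rate
/-- The rates at which the solution `z r` is uniformly asymptotically stable. -/
def IsUASRate (f : ℝ → ℝ → ℝ) (L : ℝ → ℝ) (z : ℝ → ℝ → ℝ) (r : ℝ) : Prop :=
  ∃ t₀, IsUniformlyAsymptoticallyStable (shiftField f L r) t₀ (z r)

namespace StandingAssumptions

variable {f : ℝ → ℝ → ℝ} {lm lp : ℝ} {Xs L : ℝ → ℝ} {r : ℝ} {z : ℝ → ℝ → ℝ}

theorem not_isUASRate_of_unstable (h : StandingAssumptions f lm lp Xs L)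
    (hz : ∀ r, 0 < r → IsGlobalEmanating f L (Xs lm) r (z r)) (hr : 0 < r) {Xu : ℝ}
    (hXu : IsUnstableHyperbolic f lp Xu) (hlim : Tendsto (z r) atTop (𝓝 Xu)) :
    ¬ IsUASRate f L z r := by
  obtain ⟨η, hη, T, hT⟩ := h.exists_strictMonoOn_atTop hr hXu
  rintro ⟨t₀, ht₀⟩
  exact (h.isTameField r).not_isUniformlyAsymptoticallyStable hη hT (hz r hr).1 hlim t₀ ht₀

theorem isUASRate_of_stable (h : StandingAssumptions f lm lp Xs L)
    (hz : ∀ r, 0 < r → IsGlobalEmanating f L (Xs lm) r (z r)) (hr : 0 < r) {Y : ℝ}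
    (hY : IsStableHyperbolic f lp Y) (hlim : Tendsto (z r) atTop (𝓝 Y)) : IsUASRate f L z r :=
  h.exists_isUniformlyAsymptoticallyStable hr (hz r hr).1 hlim hY

/-- The future behaviour of the emanating solution: it converges to a stable equilibrium, it
diverges and fails to track for all nearby rates, or it converges to an unstable equilibrium. -/
theorem future_trichotomy (h : StandingAssumptions f lm lp Xs L)
    (hinf : NoEquilibriumFromInfinity f lm lp)
    (hz : ∀ r, 0 < r → IsGlobalEmanating f L (Xs lm) r (z r)) (hr : 0 < r) :
    (∃ Y, IsStableHyperbolic f lp Y ∧ Tendsto (z r) atTop (𝓝 Y) ∧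
      ∀ᶠ ρ in 𝓝 r, Tendsto (z ρ) atTop (𝓝 Y)) ∨
    (∀ᶠ ρ in 𝓝 r, ¬ Tendsto (z ρ) atTop (𝓝 (Xs lp))) ∨
    ∃ Xu, IsUnstableHyperbolic f lp Xu ∧ Tendsto (z r) atTop (𝓝 Xu) := by
  rcases h.tendsto_cases hr (hz r hr).1 with h1 | h1 | ⟨l, hl, h1⟩
  · refine Or.inr (Or.inl ?_)
    filter_upwards [eventually_gt_nhds hr,
      h.eventually_not_tendsto_of_atTop hinf hr (hz r hr) h1 (Xs lp)] with ρ hρ hev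
    exact hev _ (hz ρ hρ)
  · refine Or.inr (Or.inl ?_)
    filter_upwards [eventually_gt_nhds hr,
      h.eventually_not_tendsto_of_atBot hinf hr (hz r hr) h1 (Xs lp)] with ρ hρ hev
    exact hev _ (hz ρ hρ)
  · rcases lt_or_gt_of_ne (h.deriv_ne_zero hl) with hneg | hpos
    · refine Or.inl ⟨l, ⟨hl, hneg⟩, h1, ?_⟩
      filter_upwards [eventually_gt_nhds hr,
        h.eventually_tendsto_of_stable hr (hz r hr) h1 ⟨hl, hneg⟩] with ρ hρ hev
      exact hev _ (hz ρ hρ)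
    · exact Or.inr (Or.inr ⟨l, ⟨hl, hpos⟩, h1⟩)

/-- Stability excludes the unstable case of the trichotomy, so `(0, R)` is covered by two disjoint
open sets, tracking and non-tracking. The first contains slow rates, and connectedness leaves
nothing for the second. -/
theorem tendsto_of_forall_isUASRate (h : StandingAssumptions f lm lp Xs L)
    (hinf : NoEquilibriumFromInfinity f lm lp)
    (hz : ∀ r, 0 < r → IsGlobalEmanating f L (Xs lm) r (z r)) {R : ℝ}
    (hU : ∀ r, 0 < r → r < R → IsUASRate f L z r) :
    ∀ r ∈ Ioo 0 R, Tendsto (z r) atTop (𝓝 (Xs lp)) := by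
  obtain ⟨r₁, hr₁, hslow⟩ := h.exists_forall_lt_tendsto
  set U := {r | ∀ᶠ ρ in 𝓝 r, Tendsto (z ρ) atTop (𝓝 (Xs lp))}
  set V := {r | ∀ᶠ ρ in 𝓝 r, ¬ Tendsto (z ρ) atTop (𝓝 (Xs lp))}
  intro r hr
  have hsub : Ioo 0 R ⊆ U := by
    refine IsPreconnected.subset_left_of_subset_union (v := V) isOpen_setOfPred_eventually_nhds
      isOpen_setOfPred_eventually_nhds ?_ ?_ ?_ isPreconnected_Ioo
    · exact Set.disjoint_left.2 fun ρ h1 h2 => h2.self_of_nhds h1.self_of_nhds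
    · intro ρ hρ
      rcases h.future_trichotomy hinf hz hρ.1 with ⟨Y, -, -, hev⟩ | hev | ⟨Xu, hXu, hlim⟩
      · rcases eq_or_ne Y (Xs lp) with rfl | hne
        · exact Or.inl hev
        · refine Or.inr ?_
          filter_upwards [hev] with σ hσ hσ'
          exact hne (tendsto_nhds_unique hσ hσ')
      · exact Or.inr hev
      · exact absurd (hU ρ hρ.1 hρ.2) (h.not_isUASRate_of_unstable hz hρ.1 hXu hlim)
    · have hR : 0 < R := hr.1.trans hr.2
      have hpos : 0 < min r₁ R := lt_min hr₁ hR
      refine ⟨min r₁ R / 2, ⟨half_pos hpos, (half_lt_self hpos).trans_le (min_le_right _ _)⟩, ?_⟩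
      filter_upwards [Ioo_mem_nhds (half_pos hpos)
        ((half_lt_self hpos).trans_le (min_le_left _ _))] with ρ hρ
      exact hslow ρ hρ.1 hρ.2 _ (hz ρ hρ.1)
  exact (hsub hr).self_of_nhds

/-- Uniqueness of the emanating solution reduces the existential to the chosen representative `z r`.
-/
theorem exists_attractor_iff (h : StandingAssumptions f lm lp Xs L)
    (hz : ∀ r, 0 < r → IsGlobalEmanating f L (Xs lm) r (z r)) (hr : 0 < r)
    {P : EReal → (ℝ → ℝ) → Prop} :
    (∃ b x, IsPullbackAttractor (shiftField f L r) (Xs lm) b x ∧ P b x) ↔ P ⊤ (z r) := by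
  constructor
  · rintro ⟨b, x, hx, hP⟩
    obtain ⟨rfl, hx'⟩ := (h.isPullbackAttractor_iff hr).1 hx
    rwa [h.isGlobalEmanating_unique hr hx' (hz r hr)]
  · exact fun hP => ⟨⊤, z r, (h.isPullbackAttractor_iff hr).2 ⟨rfl, hz r hr⟩, hP⟩

theorem criticalRate_eq (h : StandingAssumptions f lm lp Xs L)
    (hz : ∀ r, 0 < r → IsGlobalEmanating f L (Xs lm) r (z r)) :
    criticalRate f L (Xs lm) = sSup ((fun r : ℝ => (r : EReal)) ''
      {r : ℝ | 0 < r ∧ ∀ ρ, 0 < ρ → ρ ≤ r → IsUASRate f L z ρ}) := by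
  rw [criticalRate]
  congr 2
  ext r
  refine and_congr_right fun _ => forall_congr' fun ρ => forall_congr' fun hρ =>
    imp_congr_right fun _ => ?_
  rw [h.exists_attractor_iff hz hρ (P := fun b x => IsUASOnRay (shiftField f L ρ) b x)]
  exact and_iff_right rfl

theorem exists_forall_isUASRate_of_lt (h : StandingAssumptions f lm lp Xs L)
    (hz : ∀ r, 0 < r → IsGlobalEmanating f L (Xs lm) r (z r))
    (hlt : (r : EReal) < criticalRate f L (Xs lm)) :
    ∃ R, r < R ∧ ∀ ρ, 0 < ρ → ρ ≤ R → IsUASRate f L z ρ := by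
  rw [h.criticalRate_eq hz] at hlt
  obtain ⟨_, ⟨R, hR, rfl⟩, hrR⟩ := lt_sSup_iff.1 hlt
  exact ⟨R, EReal.coe_lt_coe_iff.1 hrR, hR.2⟩

theorem le_criticalRate (h : StandingAssumptions f lm lp Xs L)
    (hz : ∀ r, 0 < r → IsGlobalEmanating f L (Xs lm) r (z r)) (hr : 0 < r)
    (hU : ∀ ρ, 0 < ρ → ρ ≤ r → IsUASRate f L z ρ) : (r : EReal) ≤ criticalRate f L (Xs lm) := by
  rw [h.criticalRate_eq hz]
  exact le_sSup ⟨r, ⟨hr, hU⟩, rfl⟩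

theorem criticalRate_le (h : StandingAssumptions f lm lp Xs L)
    (hz : ∀ r, 0 < r → IsGlobalEmanating f L (Xs lm) r (z r)) (hr : 0 < r)
    (hU : ¬ IsUASRate f L z r) : criticalRate f L (Xs lm) ≤ r := by
  by_contra! hlt
  obtain ⟨R, hrR, hR⟩ := h.exists_forall_isUASRate_of_lt hz hlt
  exact hU (hR r hr hrR.le)

theorem tendsto_of_lt_criticalRate (h : StandingAssumptions f lm lp Xs L)
    (hinf : NoEquilibriumFromInfinity f lm lp)
    (hz : ∀ r, 0 < r → IsGlobalEmanating f L (Xs lm) r (z r)) (hr : 0 < r)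
    (hlt : (r : EReal) < criticalRate f L (Xs lm)) : Tendsto (z r) atTop (𝓝 (Xs lp)) := by
  obtain ⟨R, hrR, hR⟩ := h.exists_forall_isUASRate_of_lt hz hlt
  exact h.tendsto_of_forall_isUASRate hinf hz (fun ρ hρ hρR => hR ρ hρ hρR.le) r ⟨hr, hrR⟩

/-- At a finite critical rate, the emanating solution lands at an unstable equilibrium. -/
theorem exists_unstable_of_criticalRate_lt_top (h : StandingAssumptions f lm lp Xs L)
    (hinf : NoEquilibriumFromInfinity f lm lp)
    (hz : ∀ r, 0 < r → IsGlobalEmanating f L (Xs lm) r (z r))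
    (htop : criticalRate f L (Xs lm) < ⊤) :
    ∃ rs Xu : ℝ, 0 < rs ∧ criticalRate f L (Xs lm) = (rs : EReal) ∧
      IsUnstableHyperbolic f lp Xu ∧ Tendsto (z rs) atTop (𝓝 Xu) := by
  obtain ⟨r₁, hr₁, hslow⟩ := h.exists_forall_lt_tendsto
  -- Slow rates track a stable equilibrium, so the critical rate is positive and in particular not
  -- `⊥`.
  have hpos : ((r₁ / 2 : ℝ) : EReal) ≤ criticalRate f L (Xs lm) :=
    h.le_criticalRate hz (half_pos hr₁) fun ρ hρ hle =>
      h.isUASRate_of_stable hz hρ (h.stable_Xs lp h.lp_mem)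
        (hslow ρ hρ (hle.trans_lt (half_lt_self hr₁)) _ (hz ρ hρ))
  obtain ⟨rs, hrs⟩ : ∃ rs : ℝ, criticalRate f L (Xs lm) = (rs : EReal) :=
    ⟨_, (EReal.coe_toReal htop.ne ((EReal.bot_lt_coe _).trans_le hpos).ne').symm⟩
  have hrs0 : 0 < rs := by
    rw [hrs, EReal.coe_le_coe_iff] at hpos
    exact (half_pos hr₁).trans_le hpos
  refine ⟨rs, ?_⟩
  rcases h.future_trichotomy hinf hz hrs0 with ⟨Y, hY, -, hev⟩ | hev | ⟨Xu, hXu, hlim⟩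
  · obtain ⟨δ, hδ, hball⟩ := Metric.eventually_nhds_iff.1 hev
    -- A stable limit at `rs` would keep all rates up to `rs + δ / 2` stable, past the supremum.
    have hle : ((rs + δ / 2 : ℝ) : EReal) ≤ criticalRate f L (Xs lm) := by
      refine h.le_criticalRate hz (by positivity) fun ρ hρ hρle => ?_
      rcases lt_or_ge ρ rs with hlt | hge
      · obtain ⟨R, hR, hU⟩ := h.exists_forall_isUASRate_of_lt hz (r := ρ)
          (by rw [hrs]; exact EReal.coe_lt_coe_iff.2 hlt)
        exact hU ρ hρ hR.le
      · refine h.isUASRate_of_stable hz hρ hY (hball ?_)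
        rw [Real.dist_eq, abs_lt]
        constructor <;> linarith
    rw [hrs, EReal.coe_le_coe_iff] at hle
    linarith
  · obtain ⟨δ, hδ, hball⟩ := Metric.eventually_nhds_iff.1 hev
    have hm : 0 < min rs δ := lt_min hrs0 hδ
    have h1 : min rs δ ≤ rs := min_le_left _ _
    have h2 : min rs δ ≤ δ := min_le_right _ _
    -- This rate is positive, below critical and within `δ` of `rs`: it must both track and fail to
    -- track.
    refine absurd (h.tendsto_of_lt_criticalRate hinf hz (r := rs - min rs δ / 2) (by linarith) ?_)
      (hball ?_)
    · rw [hrs, EReal.coe_lt_coe_iff]; linarith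
    · rw [Real.dist_eq, abs_lt]
      constructor <;> linarith
  · exact ⟨Xu, hrs0, hrs, hXu, hlim⟩

end StandingAssumptions
end RateTipping

/-! ### The main theorem -/

theorem mainTheorem1 (f : ℝ → ℝ → ℝ) (lm lp : ℝ) (Xs L : ℝ → ℝ)
    (h0 : RateTipping.StandingAssumptions f lm lp Xs L)
    (hinf : RateTipping.NoEquilibriumFromInfinity f lm lp) :
    (∀ r : ℝ, 0 < r → (r : EReal) < RateTipping.criticalRate f L (Xs lm) →
      ∃ b x, RateTipping.IsPullbackAttractor (RateTipping.shiftField f L r) (Xs lm) b x ∧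
        RateTipping.EndPointTracks (Xs lp) b x) ∧
    List.TFAE [
      -- (i) the critical rate is finite
      RateTipping.criticalRate f L (Xs lm) < ⊤,
      -- (ii) loss of uniform asymptotic stability and of tracking at the critical rate
      ∃ rs : ℝ, 0 < rs ∧ RateTipping.criticalRate f L (Xs lm) = (rs : EReal) ∧
        (∃ b x, RateTipping.IsPullbackAttractor (RateTipping.shiftField f L rs) (Xs lm) b x ∧
          b = ⊤ ∧ ¬ RateTipping.IsUASOnRay (RateTipping.shiftField f L rs) b x ∧
          ¬ RateTipping.EndPointTracks (Xs lp) b x) ∧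
        RateTipping.RateInducedTippingAt f L (Xs lm) (Xs lp) rs,
      -- (iii) collision at the critical rate
      ∃ Xu rs : ℝ, RateTipping.IsUnstableHyperbolic f lp Xu ∧ 0 < rs ∧
        RateTipping.criticalRate f L (Xs lm) = (rs : EReal) ∧
        RateTipping.CollideAt f L (Xs lm) Xu rs,
      -- (iii') collision at some rate
      ∃ Xu r : ℝ, RateTipping.IsUnstableHyperbolic f lp Xu ∧ 0 < r ∧
        RateTipping.CollideAt f L (Xs lm) Xu r] := by
  choose! z hz using fun r (hr : 0 < r) => h0.exists_isGlobalEmanating hr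
  have hatt : ∀ {r : ℝ}, 0 < r →
      RateTipping.IsPullbackAttractor (RateTipping.shiftField f L r) (Xs lm) ⊤ (z r) :=
    fun hr => (h0.isPullbackAttractor_iff hr).2 ⟨rfl, hz _ hr⟩
  have htrack : ∀ r : ℝ, 0 < r → (r : EReal) < RateTipping.criticalRate f L (Xs lm) →
      ∃ b x, RateTipping.IsPullbackAttractor (RateTipping.shiftField f L r) (Xs lm) b x ∧
        RateTipping.EndPointTracks (Xs lp) b x := fun r hr hlt =>
    ⟨⊤, z r, hatt hr, rfl, h0.tendsto_of_lt_criticalRate hinf hz hr hlt⟩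
  refine ⟨htrack, ?_⟩
  tfae_have 1 → 2 := by
    intro htop
    obtain ⟨rs, Xu, hrs, hcrit, hXu, hlim⟩ :=
      h0.exists_unstable_of_criticalRate_lt_top hinf hz htop
    have hnot : ¬ RateTipping.EndPointTracks (Xs lp) ⊤ (z rs) := fun ⟨_, ht⟩ => by
      have h1 := hXu.2
      rw [tendsto_nhds_unique hlim ht] at h1
      exact lt_asymm h1 (h0.stable_Xs lp h0.lp_mem).2
    refine ⟨rs, hrs, hcrit, ⟨⊤, z rs, hatt hrs, rfl, fun ⟨_, hU⟩ => ?_, hnot⟩, hrs,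
      fun r hr hlt => htrack r hr ?_, ⊤, z rs, hatt hrs, hnot⟩
    · exact h0.not_isUASRate_of_unstable hz hrs hXu hlim hU
    · rw [hcrit]
      exact EReal.coe_lt_coe_iff.2 hlt
  tfae_have 1 → 3 := by
    intro htop
    obtain ⟨rs, Xu, hrs, hcrit, hXu, hlim⟩ :=
      h0.exists_unstable_of_criticalRate_lt_top hinf hz htop
    obtain ⟨η, hη, T, hT⟩ := h0.exists_strictMonoOn_atTop hrs hXu
    -- The same solution serves as attractor and repeller, since it is global and lands at the
    -- unstable equilibrium.
    exact ⟨Xu, rs, hXu, hrs, hcrit, ⊤, z rs, ⊥, z rs, hatt hrs,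
      (h0.isTameField rs).isPullbackRepeller hη hT (hz rs hrs).1 hlim, rfl, rfl, fun _ => rfl⟩
  tfae_have 2 → 1 := fun ⟨rs, _, hcrit, _⟩ => hcrit ▸ EReal.coe_lt_top rs
  tfae_have 3 → 4 := fun ⟨Xu, rs, hXu, hrs, _, hcol⟩ => ⟨Xu, rs, hXu, hrs, hcol⟩
  tfae_have 4 → 1 := by
    rintro ⟨Xu, r, hXu, hr, b, x, a, y, hx, hy, -, -, hxy⟩
    obtain ⟨-, hx'⟩ := (h0.isPullbackAttractor_iff hr).1 hx
    -- The collision transfers the repeller's limit to the emanating solution, so `r` is not a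
    -- stable rate and bounds the critical rate.
    have hlim : Tendsto (z r) atTop (𝓝 Xu) := by
      rw [← h0.isGlobalEmanating_unique hr (hz r hr) hx', funext hxy]
      exact hy.1.2.2
    exact (h0.criticalRate_le hz hr (h0.not_isUASRate_of_unstable hz hr hXu hlim)).trans_lt
      (EReal.coe_lt_top r)
  tfae_finish
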